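/- Let $d\ge 1$, let $X\subset\mathbb{R}^d$ be a non-empty compact set with $\overline{\operatorname{int}(X)}=X$, let $V\supset X$ be open and connected, and fix constants $K\ge 1$, $\eta<1$, $N\in\mathbb{N}$ and a sequence $J=(I^{(n)})_{n\ge 1}$ of non-empty finite sets. Consider the non-autonomous conformal iterated function systems $\Phi=(\varphi^{(n)}_a)_{n\ge1,\,a\in I^{(n)}}$ on $X$ with alphabet $J$ and these data, i.e. families of maps $\varphi_a^{(n)}:X\to X$ such that: (i) $\varphi_a^{(n)}(\operatorname{int}X)\cap\varphi_b^{(n)}(\operatorname{int}X)=\emptyset$ for all $n$ and all $a\neq b$ in $I^{(n)}$; (ii) each $\varphi_a^{(n)}$ extends to a $C^1$ conformal diffeomorphism of $V$ into $V$ (orientation-reversing maps are allowed); (iii) $|D\varphi(x)|\le K|D\varphi(y)|$ for all $x,y\in V$ and every finite composition $\varphi=\varphi^{(k)}_{\omega_k}\circ\dots\circ\varphi^{(l)}_{\omega_l}$, $k\le l$, $\omega_j\in I^{(j)}$ (of the extensions); (iv) $|D\varphi(x)|\le\eta^m$ for all $m\ge N$, all $x\in X$ and all $\varphi=\varphi^{(k)}_{\omega_k}\circ\dots\circ\varphi^{(k+m)}_{\omega_{k+m}}$.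 Here $|D\varphi(x)|$ is the scaling factor of the similarity $D\varphi(x)$. Let $\mathcal{K}_u(X,J)$ be the set of those systems for which moreover $\inf\{|D\varphi_a^{(n)}(x)|:n\ge1,\,a\in I^{(n)},\,x\in X\}>0$, and for every $\varepsilon>0$ there is $\delta>0$ such that $\big||D\varphi_a^{(n)}(x)|-|D\varphi_a^{(n)}(y)|\big|<\varepsilon$ for all $n$, all $a\in I^{(n)}$ and all $x,y\in X$ with $|x-y|<\delta$. Endow $\mathcal{K}_u(X,J)$ with the uniform metric $$d_u(\Phi,\Psi)=\sup_{n\ge 1}\ \max_{a\in I^{(n)}}\ \max\Big\{\sup_{x\in X}|\varphi_a^{(n)}(x)-\psi_a^{(n)}(x)|,\ \sup_{x\in X}\|D\varphi_a^{(n)}(x)-D\psi_a^{(n)}(x)\|\Big\}.$$ For $\omega\in I^n=\prod_{j=1}^n I^{(j)}$ put $\varphi_\omega=\varphi^{(1)}_{\omega_1}\circ\dots\circ\varphi^{(n)}_{\omega_n}$ and $\|D\varphi_\omega\|=\sup_{x\in X}|D\varphi_\omega(x)|$. Define the lower pressure $\underline{P}^\Phi(t)=\liminf_{n\to\infty}\frac1n\log\sum_{\omega\in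 I^n}\|D\varphi_\omega\|^t$ for $t\ge 0$, and the limit set $J(\Phi)=\bigcap_{n\ge1}\bigcup_{\omega\in I^n}\varphi_\omega(X)$. Then for every $t\ge0$ the lower pressure $\Psi\mapsto\underline{P}^\Psi(t)$ is a finite-valued (real) continuous function on $(\mathcal{K}_u(X,J),d_u)$. Moreover, the Hausdorff dimension function $\mathcal{K}_u(X,J)\to[0,d]$, $\Phi\mapsto\operatorname{HD}(J(\Phi))$, is continuous. -/

import Mathlib

open Set

namespace NonAut

universe u

/-- Finite words `ω_k ω_{k+1} … ω_{k+n-1}` of length `n` starting at level `k`, over the alphabets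
`I 0, I 1, I 2, …` (levels are numbered from `0`). `Word I 0 n` is the set of initial words. -/
abbrev Word (I : ℕ → Type u) (k n : ℕ) : Type u := ∀ j : Fin n, I ((j : ℕ) + k)

/-- The composition `φ^{(k)}_{ω_k} ∘ φ^{(k+1)}_{ω_{k+1}} ∘ … ∘ φ^{(k+n-1)}_{ω_{k+n-1}}`. -/
def wordMap {I : ℕ → Type u} {E : Type*} (φ : ∀ n, I n → E → E) (k : ℕ) :
    ∀ n : ℕ, Word I k n → E → E
  | 0, _ => id
  | n + 1, ω =>
      wordMap φ k n (fun j => ω j.castSucc) ∘ φ (n + k) (ω (Fin.last n))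

/-- Non-autonomous conformal iterated function systems on `X ⊆ ℝ^d` with alphabets `I n`, for a
fixed domain `V ⊇ X`, a fixed distortion constant `K`, a fixed contraction constant `η` and a fixed
threshold `N` from which on the uniform contraction estimate holds.
The maps are given together with their conformal extensions to `V`; they are total functions on
`ℝ^d`, whose values off `V` play no role. -/
structure NCIFS {d : ℕ} (X V : Set (EuclideanSpace ℝ (Fin d))) (K η : ℝ) (N : ℕ)
    (I : ℕ → Type u) where
  /-- the map `φ_a^{(n)}` -/
  map : ∀ n, I n → EuclideanSpace ℝ (Fin d) → EuclideanSpace ℝ (Fin d)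
  mapsTo : ∀ n a, MapsTo (map n a) X X
  /-- open set condition -/
  openSet : ∀ n (a b : I n), a ≠ b →
    Disjoint (map n a '' interior X) (map n b '' interior X)
  /-- conformality: `map n a` is a `C¹` conformal diffeomorphism of `V` into `V` -/
  mapsTo_domain : ∀ n a, MapsTo (map n a) V V
  injOn : ∀ n a, InjOn (map n a) V
  contDiffOn : ∀ n a, ContDiffOn ℝ 1 (map n a) V
  conformal : ∀ n a, ∀ x ∈ V, ConformalAt (map n a) x
  /-- bounded distortion -/
  distortion : ∀ k n, ∀ ω : Word I k (n + 1), ∀ x ∈ V, ∀ y ∈ V,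
    ‖fderiv ℝ (wordMap map k (n + 1) ω) x‖ ≤ K * ‖fderiv ℝ (wordMap map k (n + 1) ω) y‖
  /-- uniform contraction, for words `ω_k … ω_{k+m}` with `m ≥ N` -/
  contraction : ∀ m, N ≤ m → ∀ k, ∀ ω : Word I k (m + 1), ∀ x ∈ X,
    ‖fderiv ℝ (wordMap map k (m + 1) ω) x‖ ≤ η ^ m

namespace NCIFS

variable {d : ℕ} {X V : Set (EuclideanSpace ℝ (Fin d))} {K η : ℝ} {N : ℕ} {I : ℕ → Type u}

/-- The limit set `J(Φ) = ⋂_{n ≥ 1} ⋃_{ω ∈ I^n} φ_ω(X)`. -/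
def limitSet (Φ : NCIFS X V K η N I) : Set (EuclideanSpace ℝ (Fin d)) :=
  ⋂ (n : ℕ) (_ : 1 ≤ n), ⋃ ω : Word I 0 n, wordMap Φ.map 0 n ω '' X

/-- `‖Dφ_ω‖ = sup_{x ∈ X} |Dφ_ω(x)|` for an initial word `ω`. The scaling factor of a similarity
linear map is its operator norm. -/
noncomputable def derivNorm (Φ : NCIFS X V K η N I) (n : ℕ) (ω : Word I 0 n) : ℝ :=
  ⨆ x : X, ‖fderiv ℝ (wordMap Φ.map 0 n ω) (x : EuclideanSpace ℝ (Fin d))‖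

/-- `Z_n(t) = ∑_{ω ∈ I^n} ‖Dφ_ω‖^t`. -/
noncomputable def partitionSum [∀ n, Fintype (I n)] (Φ : NCIFS X V K η N I) (n : ℕ) (t : ℝ) : ℝ :=
  ∑ ω : Word I 0 n, Φ.derivNorm n ω ^ t

/-- The lower pressure `liminf_{n → ∞} (1/n) log Z_n(t)`, as an extended real number. -/
noncomputable def lowerPressure [∀ n, Fintype (I n)] (Φ : NCIFS X V K η N I) (t : ℝ) : EReal :=
  Filter.liminf (fun n : ℕ => ((1 / (n : ℝ) * Real.log (Φ.partitionSum n t) : ℝ) : EReal))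
    Filter.atTop

/-- The derivatives are bounded below on `X` by a positive constant. -/
def DerivBoundedBelow (Φ : NCIFS X V K η N I) : Prop :=
  ∃ κ : ℝ, 0 < κ ∧ ∀ n a, ∀ x ∈ X, κ ≤ ‖fderiv ℝ (Φ.map n a) x‖

/-- The family `|Dφ_a^{(n)}|` is uniformly equicontinuous on `X`. -/
def DerivUniformlyContinuous (Φ : NCIFS X V K η N I) : Prop :=
  ∀ ε : ℝ, 0 < ε → ∃ δ : ℝ, 0 < δ ∧ ∀ n a, ∀ x ∈ X, ∀ y ∈ X, ‖x - y‖ < δ →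
    |‖fderiv ℝ (Φ.map n a) x‖ - ‖fderiv ℝ (Φ.map n a) y‖| < ε

/-- The uniform distance `d_u(Φ, Ψ)`: the supremum over all `n`, `a ∈ I n`, `x ∈ X` of
`|φ_a^{(n)}(x) - ψ_a^{(n)}(x)|` and `‖Dφ_a^{(n)}(x) - Dψ_a^{(n)}(x)‖`. It vanishes exactly when
the maps of the two systems (and their derivatives) agree on `X`. -/
noncomputable instance : PseudoEMetricSpace (NCIFS X V K η N I) where
  edist Φ Ψ := ⨆ (n : ℕ) (a : I n) (x : X),
    max (edist (Φ.map n a x) (Ψ.map n a x))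
      (edist (fderiv ℝ (Φ.map n a) x) (fderiv ℝ (Ψ.map n a) x))
  edist_self Φ := by simp
  edist_comm Φ Ψ := by simp only [edist_comm]
  edist_triangle Φ Ψ Θ := by
    refine iSup_le fun n => iSup_le fun a => iSup_le fun x => ?_
    refine le_trans ?_ (add_le_add
      (le_iSup_of_le n (le_iSup_of_le a (le_iSup_of_le x le_rfl)))
      (le_iSup_of_le n (le_iSup_of_le a (le_iSup_of_le x le_rfl))))
    refine max_le ?_ ?_
    · exact (edist_triangle _ _ _).trans (add_le_add (le_max_left _ _) (le_max_left _ _))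
    · exact (edist_triangle _ _ _).trans (add_le_add (le_max_right _ _) (le_max_right _ _))

end NCIFS

/-- The space `K_u(X, J)` (where `J = (I n)_n`), with the uniform distance `d_u`. -/
abbrev Ku {d : ℕ} (X V : Set (EuclideanSpace ℝ (Fin d))) (K η : ℝ) (N : ℕ) (I : ℕ → Type u) :=
  {Φ : NCIFS X V K η N I // Φ.DerivBoundedBelow ∧ Φ.DerivUniformlyContinuous}

end NonAut

/-! ### Conformal linear maps, Lipschitz bounds, and covers for Hausdorff measure -/

section General

open Filter Topology Metric MeasureTheory
open scoped ENNReal NNReal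

universe v

/-! Norms of conformal derivatives multiply, so the scaling factor of a word is a product of
one-letter factors along an orbit. If `Ψ` is close to `Φ`, uniform contraction keeps the orbits of
the two systems along the same letters uniformly close; equicontinuity and the lower bound on the
derivatives then put each quotient of one-letter factors between `1/c` and `c`. Hence scaling
factors of words of length `n` agree up to `c ^ n` (`eventually_scale_le`), with `c > 1` arbitrarily
close to `1`.

Pressure: the lower pressures differ by at most `t * log c`. They are finite because cylinders have
disjoint interiors inside `X`, so a volume count bounds the number of words exponentially.

Dimension: take `c = η ^ (-θ)`. A stopped word with `Φ`-scale comparable to `r` has `η ^ n` at least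
a constant times `r`, so its `Ψ`-scale is at most a constant times `r ^ (1 - θ)`. By the volume
count, boundedly many such words have cylinders meeting a given ball of radius `r`
(`exists_cover_of_closedBall`). Covers of `J(Φ)` thus become covers of `J(Ψ)`, giving `(1 - θ) *
dimH J(Ψ) ≤ dimH J(Φ)` and the same with the roles exchanged. -/

theorem IsConformalMap.norm_comp {E : Type*} [NormedAddCommGroup E] [NormedSpace ℝ E]
    [Nontrivial E] {f g : E →L[ℝ] E} (hf : IsConformalMap f) (hg : IsConformalMap g) :
    ‖f.comp g‖ = ‖f‖ * ‖g‖ := by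
  obtain ⟨a, -, u, rfl⟩ := hf
  obtain ⟨b, -, v, rfl⟩ := hg
  have : (a • u.toContinuousLinearMap).comp (b • v.toContinuousLinearMap)
      = (a * b) • (u.comp v).toContinuousLinearMap := by
    ext x
    simp [mul_smul, smul_comm b a]
  rw [this, norm_smul, norm_smul, norm_smul, LinearIsometry.norm_toContinuousLinearMap,
    LinearIsometry.norm_toContinuousLinearMap, LinearIsometry.norm_toContinuousLinearMap,
    norm_mul]
  ring

/-- A scalar multiple of an isometry multiplies volume by a power of the scalar. This converts
scaling factors into volumes of cylinders. -/
theorem IsConformalMap.abs_det {E : Type*} [NormedAddCommGroup E] [InnerProductSpace ℝ E]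
    [FiniteDimensional ℝ E] [Nontrivial E] {f : E →L[ℝ] E} (hf : IsConformalMap f) :
    |f.det| = ‖f‖ ^ Module.finrank ℝ E := by
  obtain ⟨a, -, u, rfl⟩ := hf
  rw [norm_smul, LinearIsometry.norm_toContinuousLinearMap, ContinuousLinearMap.det,
    ← LinearMap.normDet_eq_abs_det]
  have h := LinearMap.normDet_smul u.toLinearMap a
  rw [LinearIsometry.normDet_eq_one, mul_one] at h
  rw [mul_one]
  exact h

/-- A differentiable map with derivative bounded by `L` on a connected open set is Lipschitz on
compact subsets, with a constant proportional to `L`. -/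
theorem IsCompact.exists_norm_sub_le_of_norm_fderiv_le {E F : Type*} [NormedAddCommGroup E]
    [NormedSpace ℝ E] [NormedAddCommGroup F] [NormedSpace ℝ F] {X V : Set E}
    (hX : IsCompact X) (hVo : IsOpen V) (hVc : IsPreconnected V) (hXV : X ⊆ V) :
    ∃ C : ℝ, 0 < C ∧ ∀ (f : E → F) (L : ℝ), 0 ≤ L → (∀ x ∈ V, DifferentiableAt ℝ f x) →
      (∀ x ∈ V, ‖fderiv ℝ f x‖ ≤ L) → ∀ x ∈ X, ∀ y ∈ X, ‖f x - f y‖ ≤ C * L * ‖x - y‖ := by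
  have hloc : ∀ x ∈ V, ∃ r > 0, ball x r ⊆ V := fun x hx => Metric.isOpen_iff.1 hVo x hx
  -- `V` need not be convex: the mean value inequality is used on balls, and `P` records bounds that
  -- can be chained through connectedness.
  let P : E → E → ℝ → Prop := fun x y C => ∀ (f : E → F) (L : ℝ), 0 ≤ L →
    (∀ x ∈ V, DifferentiableAt ℝ f x) → (∀ x ∈ V, ‖fderiv ℝ f x‖ ≤ L) → ‖f x - f y‖ ≤ C * L
  have hPball : ∀ x r, ball x r ⊆ V → ∀ y ∈ ball x r, P x y r := by
    intro x r hr y hy f L hL hf hfL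
    have hrpos : 0 < r := dist_nonneg.trans_lt (mem_ball.1 hy)
    have h := (convex_ball x r).norm_image_sub_le_of_norm_fderiv_le
      (fun z hz => hf z (hr hz)) (fun z hz => hfL z (hr hz)) hy (mem_ball_self hrpos)
    have h2 : ‖x - y‖ ≤ r := by rw [← dist_eq_norm, dist_comm]; exact (mem_ball.1 hy).le
    nlinarith
  have hPsymm : ∀ x y C, P x y C → P y x C := by
    intro x y C h f L hL hf hfL
    rw [norm_sub_rev]
    exact h f L hL hf hfL
  have hPtrans : ∀ x y z C D, P x y C → P y z D → P x z (C + D) := by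
    intro x y z C D h h' f L hL hf hfL
    have := norm_sub_le_norm_sub_add_norm_sub (f x) (f y) (f z)
    linarith [h f L hL hf hfL, h' f L hL hf hfL]
  have hPV : ∀ x ∈ V, ∀ y ∈ V, ∃ C, P x y C := by
    intro x hx y hy
    refine hVc.induction₂ (fun x y => ∃ C, P x y C) ?_ ?_ ?_ hx hy
    · intro x hx
      obtain ⟨r, hr, hrV⟩ := hloc x hx
      filter_upwards [mem_nhdsWithin_of_mem_nhds (ball_mem_nhds x hr)] with y hy
      exact ⟨r, hPball x r hrV y hy⟩
    · rintro x y z - - - ⟨C, hC⟩ ⟨D, hD⟩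
      exact ⟨C + D, hPtrans _ _ _ _ _ hC hD⟩
    · rintro x y - - ⟨C, hC⟩
      exact ⟨C, hPsymm _ _ _ hC⟩
  rcases X.eq_empty_or_nonempty with rfl | ⟨x₀, hx₀⟩
  · exact ⟨1, one_pos, by simp⟩
  have hPX : ∃ C, ∀ x ∈ X, P x x₀ C := by
    refine hX.induction_on (p := fun s => ∃ C, ∀ x ∈ s, P x x₀ C) ⟨0, by simp⟩ ?_ ?_ ?_
    · rintro s t hst ⟨C, hC⟩
      exact ⟨C, fun x hx => hC x (hst hx)⟩
    · rintro s t ⟨C, hC⟩ ⟨D, hD⟩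
      refine ⟨max C D, ?_⟩
      rintro x (hx | hx) f L hL hf hfL
      · exact (hC x hx f L hL hf hfL).trans (mul_le_mul_of_nonneg_right (le_max_left _ _) hL)
      · exact (hD x hx f L hL hf hfL).trans (mul_le_mul_of_nonneg_right (le_max_right _ _) hL)
    · intro x hx
      obtain ⟨r, hr, hrV⟩ := hloc x (hXV hx)
      obtain ⟨C, hC⟩ := hPV x (hXV hx) x₀ (hXV hx₀)
      exact ⟨ball x r, mem_nhdsWithin_of_mem_nhds (ball_mem_nhds x hr), r + C, fun y hy =>
        hPtrans _ _ _ _ _ (hPsymm _ _ _ (hPball x r hrV y hy)) hC⟩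
  obtain ⟨C, hC⟩ := hPX
  obtain ⟨r, hr, hrV⟩ := hX.exists_thickening_subset_open hVo hXV
  -- The `1` serves pairs inside a common ball of `V`; for pairs at distance at least `r`, the
  -- uniform bound `2 * C * L` is at most `2 * C / r * L * ‖x - y‖`.
  refine ⟨max 1 (2 * C / r), by positivity, ?_⟩
  intro f L hL hf hfL x hx y hy
  rcases lt_or_ge ‖x - y‖ r with hxy | hxy
  · have hb : ball x r ⊆ V := (ball_subset_thickening hx r).trans hrV
    have h := (convex_ball x r).norm_image_sub_le_of_norm_fderiv_le
      (fun z hz => hf z (hb hz)) (fun z hz => hfL z (hb hz))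
      (show y ∈ ball x r by rwa [mem_ball, dist_comm, dist_eq_norm]) (mem_ball_self hr)
    refine h.trans (mul_le_mul_of_nonneg_right ?_ (norm_nonneg _))
    exact le_mul_of_one_le_left hL (le_max_left _ _)
  · have h : ‖f x - f y‖ ≤ (C + C) * L :=
      hPtrans _ _ _ _ _ (hC x hx) (hPsymm _ _ _ (hC y hy)) f L hL hf hfL
    have hC0 : 0 ≤ (C + C) * L := (norm_nonneg _).trans h
    calc ‖f x - f y‖ ≤ (C + C) * L := h
      _ ≤ (C + C) * L * (‖x - y‖ / r) :=
        le_mul_of_one_le_right hC0 ((one_le_div hr).2 hxy)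
      _ = (2 * C / r) * L * ‖x - y‖ := by ring
      _ ≤ max 1 (2 * C / r) * L * ‖x - y‖ := by gcongr; exact le_max_right _ _

/-- A set of vanishing Hausdorff measure is covered by countably many closed balls of positive radii
with small `s`-sum of radii. -/
theorem exists_closedBall_cover_of_hausdorffMeasure_eq_zero {E : Type*} [EMetricSpace E]
    [MeasurableSpace E] [BorelSpace E] [Nonempty E] {A : Set E} {s : ℝ} (hs : 0 < s)
    (hA : Measure.hausdorffMeasure s A = 0) {ε : ℝ≥0∞} (hε : ε ≠ 0) :
    ∃ (x : ℕ → E) (r : ℕ → ℝ≥0), (∀ i, 0 < r i) ∧ A ⊆ ⋃ i, closedEBall (x i) (r i) ∧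
      ∑' i, (r i : ℝ≥0∞) ^ s ≤ ε := by
  rw [Measure.hausdorffMeasure_apply] at hA
  have h1 := (ENNReal.iSup_eq_zero.1 (ENNReal.iSup_eq_zero.1 hA 1)) one_pos
  have hε2 : (0 : ℝ≥0∞) < ε / 2 := ENNReal.half_pos hε
  rw [← h1] at hε2
  simp only [iInf_lt_iff] at hε2
  obtain ⟨t, hAt, ht1, hsum⟩ := hε2
  obtain ⟨δ, hδ, hδsum⟩ := ENNReal.exists_pos_sum_of_countable (ENNReal.half_pos hε).ne' ℕ
  have hx : ∀ i, ∃ x : E, t i ⊆ closedEBall x (ediam (t i)) := by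
    intro i
    rcases (t i).eq_empty_or_nonempty with h | ⟨x, hx⟩
    · exact ⟨Classical.arbitrary E, by simp [h]⟩
    · exact ⟨x, fun y hy => mem_closedEBall.2 (edist_le_ediam_of_mem hy hx)⟩
  choose x hx using hx
  have hfin : ∀ i, ediam (t i) ≠ ∞ := fun i => ((ht1 i).trans_lt ENNReal.one_lt_top).ne
  -- The maximum makes every radius positive, even for pieces of diameter zero, and adds at most `∑
  -- δ i ≤ ε / 2` to the sum.
  refine ⟨x, fun i => max (ediam (t i)).toNNReal (δ i ^ (1 / s)), ?_, ?_, ?_⟩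
  · intro i
    exact lt_max_of_lt_right (NNReal.rpow_pos (hδ i))
  · refine hAt.trans (iUnion_mono fun i => (hx i).trans (closedEBall_subset_closedEBall ?_))
    rw [← ENNReal.coe_toNNReal (hfin i)]
    exact_mod_cast le_max_left _ _
  · calc ∑' i, ((max (ediam (t i)).toNNReal (δ i ^ (1 / s)) : ℝ≥0) : ℝ≥0∞) ^ s
        ≤ ∑' i, ((⨆ _ : (t i).Nonempty, ediam (t i) ^ s) + δ i) := by
          refine ENNReal.tsum_le_tsum fun i => ?_
          rcases le_total (ediam (t i)).toNNReal (δ i ^ (1 / s)) with h | h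
          · rw [max_eq_right h, ← ENNReal.coe_rpow_of_nonneg _ hs.le, ← NNReal.rpow_mul,
              one_div_mul_cancel hs.ne', NNReal.rpow_one]
            exact le_add_self
          · rw [max_eq_left h, ENNReal.coe_toNNReal (hfin i)]
            rcases (t i).eq_empty_or_nonempty with h' | h'
            · simp [h', hs]
            · simp [h']
      _ = (∑' i, ⨆ _ : (t i).Nonempty, ediam (t i) ^ s) + ∑' i, (δ i : ℝ≥0∞) :=
          ENNReal.tsum_add
      _ ≤ ε / 2 + ε / 2 := by
          exact add_le_add hsum.le hδsum.le
      _ = ε := ENNReal.add_halves ε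

/-- No separate mesh condition is needed: each diameter is at most the `1 / s` power of the whole
sum, so the mesh tends to zero with it. -/
theorem hausdorffMeasure_eq_zero_of_forall_cover {E : Type*} [EMetricSpace E] [MeasurableSpace E]
    [BorelSpace E] {A : Set E} {s : ℝ} (hs : 0 < s)
    (h : ∀ ε : ℝ≥0, 0 < ε → ∃ (ι : Type v) (_ : Countable ι) (t : ι → Set E), A ⊆ ⋃ i, t i ∧
      ∑' i, ediam (t i) ^ s ≤ ε) :
    Measure.hausdorffMeasure s A = 0 := by
  have h' : ∀ n : ℕ, ∃ (ι : Type v) (_ : Countable ι) (t : ι → Set E), A ⊆ ⋃ i, t i ∧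
      ∑' i, ediam (t i) ^ s ≤ (((n + 1 : ℝ≥0)⁻¹ : ℝ≥0) : ℝ≥0∞) := fun n => h _ (by positivity)
  choose ι hι t hAt hsum using h'
  have hlim : Tendsto (fun n : ℕ => (((n + 1 : ℝ≥0)⁻¹ : ℝ≥0) : ℝ≥0∞)) atTop (𝓝 0) := by
    have : Tendsto (fun n : ℕ => ((n + 1 : ℝ≥0)⁻¹ : ℝ≥0)) atTop (𝓝 0) := by
      simpa using tendsto_one_div_add_atTop_nhds_zero_nat (𝕜 := ℝ≥0)
    simpa only [ENNReal.coe_zero] using ENNReal.tendsto_coe.2 this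
  have hr : Tendsto (fun n : ℕ => (((n + 1 : ℝ≥0)⁻¹ : ℝ≥0) : ℝ≥0∞) ^ (1 / s)) atTop (𝓝 0) := by
    have := hlim.ennrpow_const (1 / s)
    rwa [ENNReal.zero_rpow_of_pos (by positivity)] at this
  have hle := Measure.hausdorffMeasure_le_liminf_tsum (l := atTop) s A _ hr t
    (Eventually.of_forall fun n i => by
      have := ENNReal.rpow_le_rpow ((ENNReal.le_tsum i).trans (hsum n)) (one_div_pos.2 hs).le
      rwa [← ENNReal.rpow_mul, mul_one_div_cancel hs.ne', ENNReal.rpow_one] at this)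
    (Eventually.of_forall hAt)
  refine le_antisymm (hle.trans ?_) zero_le
  exact (liminf_le_liminf (Eventually.of_forall hsum)).trans hlim.liminf_eq.le

end General

/-! ### Compositions along a sequence of letters and their scaling factors -/

namespace NonAut

universe u

/-- The composition `g k ∘ g (k + 1) ∘ … ∘ g (k + n - 1)`. -/
def seqComp {E : Type*} (g : ℕ → E → E) (k : ℕ) : ℕ → E → E
  | 0 => id
  | n + 1 => seqComp g k n ∘ g (n + k)

section SeqComp

variable {E : Type*} {g h : ℕ → E → E}

theorem seqComp_succ_left (g : ℕ → E → E) (k n : ℕ) :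
    seqComp g k (n + 1) = g k ∘ seqComp g (k + 1) n := by
  induction n with
  | zero => simp [seqComp]
  | succ n ih =>
    rw [seqComp, ih, Function.comp_assoc, seqComp, show n + 1 + k = n + (k + 1) by ring]

theorem seqComp_add (g : ℕ → E → E) (k m n : ℕ) :
    seqComp g k (m + n) = seqComp g k m ∘ seqComp g (m + k) n := by
  induction n with
  | zero => simp [seqComp]
  | succ n ih =>
    rw [← add_assoc, seqComp, ih, Function.comp_assoc, seqComp, show m + n + k = n + (m + k) by ring]

theorem seqComp_congr {k n : ℕ} (hgh : ∀ i < n, g (i + k) = h (i + k)) :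
    seqComp g k n = seqComp h k n := by
  induction n with
  | zero => rfl
  | succ n ih => rw [seqComp, seqComp, ih fun i hi => hgh i (by lia), hgh n (by lia)]

theorem seqComp_mapsTo {S : Set E} (hg : ∀ i, MapsTo (g i) S S) (k n : ℕ) :
    MapsTo (seqComp g k n) S S := by
  induction n with
  | zero => exact mapsTo_id S
  | succ n ih => exact ih.comp (hg _)

theorem seqComp_injOn {S : Set E} (hg : ∀ i, MapsTo (g i) S S) (hgi : ∀ i, InjOn (g i) S)
    (k n : ℕ) : InjOn (seqComp g k n) S := by
  induction n with
  | zero => exact injOn_id S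
  | succ n ih => exact ih.comp (hgi _) (hg _)

theorem seqComp_conformalAt {E : Type*} [NormedAddCommGroup E] [NormedSpace ℝ E]
    {g : ℕ → E → E} {S : Set E} (hg : ∀ i, MapsTo (g i) S S)
    (hgc : ∀ i, ∀ x ∈ S, ConformalAt (g i) x) (k n : ℕ) :
    ∀ x ∈ S, ConformalAt (seqComp g k n) x := by
  induction n with
  | zero => exact fun x _ => conformalAt_id x
  | succ n ih => exact fun x hx => (ih _ (hg _ hx)).comp x (hgc _ x hx)

end SeqComp

theorem isConformalMap_fderiv {E : Type*} [NormedAddCommGroup E] [NormedSpace ℝ E]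
    {f : E → E} {x : E} (hf : ConformalAt f x) : IsConformalMap (fderiv ℝ f x) := by
  obtain ⟨f', hf', h⟩ := hf
  rwa [hf'.fderiv]

theorem norm_fderiv_comp_of_conformalAt {E : Type*} [NormedAddCommGroup E] [NormedSpace ℝ E]
    [Nontrivial E] {f g : E → E} {x : E} (hf : ConformalAt f (g x)) (hg : ConformalAt g x) :
    ‖fderiv ℝ (f ∘ g) x‖ = ‖fderiv ℝ f (g x)‖ * ‖fderiv ℝ g x‖ := by
  rw [fderiv_comp x hf.differentiableAt hg.differentiableAt]
  exact (isConformalMap_fderiv hf).norm_comp (isConformalMap_fderiv hg)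

theorem norm_fderiv_pos_of_conformalAt {E : Type*} [NormedAddCommGroup E] [NormedSpace ℝ E]
    [Nontrivial E] {f : E → E} {x : E} (hf : ConformalAt f x) : 0 < ‖fderiv ℝ f x‖ :=
  norm_pos_iff.2 (isConformalMap_fderiv hf).ne_zero

namespace NCIFS

variable {d : ℕ} {X V : Set (EuclideanSpace ℝ (Fin d))} {K η : ℝ} {N : ℕ} {I : ℕ → Type u}

/-- The composition of the maps of `Φ` along `n` letters of the sequence `ω`, from level `k` on. -/
def comp (Φ : NCIFS X V K η N I) (ω : ∀ n, I n) (k n : ℕ) :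
    EuclideanSpace ℝ (Fin d) → EuclideanSpace ℝ (Fin d) :=
  seqComp (fun i => Φ.map i (ω i)) k n

variable (Φ : NCIFS X V K η N I) (ω : ∀ n, I n)

theorem wordMap_eq_comp (k n : ℕ) : wordMap Φ.map k n (fun j => ω (j + k)) = Φ.comp ω k n := by
  induction n with
  | zero => rfl
  | succ n ih =>
    rw [comp, seqComp, ← comp, ← ih]
    rfl

/-- An infinite sequence of letters with prescribed initial word. -/
noncomputable def _root_.NonAut.Word.extend [∀ n, Nonempty (I n)] {n : ℕ} (w : Word I 0 n) :
    ∀ i, I i :=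
  fun i => if h : i < n then w ⟨i, h⟩ else Classical.arbitrary _

theorem _root_.NonAut.Word.extend_apply [∀ n, Nonempty (I n)] {n : ℕ} (w : Word I 0 n) (j : Fin n) :
    w.extend (j : ℕ) = w j := by
  simp [Word.extend]

theorem wordMap_eq_comp_extend [∀ n, Nonempty (I n)] {n : ℕ} (w : Word I 0 n) :
    wordMap Φ.map 0 n w = Φ.comp w.extend 0 n := by
  rw [← wordMap_eq_comp]
  congr 1
  funext j
  exact (Word.extend_apply w j).symm

theorem comp_succ (k n : ℕ) : Φ.comp ω k (n + 1) = Φ.comp ω k n ∘ Φ.map (n + k) (ω (n + k)) := rfl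

theorem comp_succ_left (k n : ℕ) :
    Φ.comp ω k (n + 1) = Φ.map k (ω k) ∘ Φ.comp ω (k + 1) n :=
  seqComp_succ_left _ _ _

theorem comp_add (k m n : ℕ) : Φ.comp ω k (m + n) = Φ.comp ω k m ∘ Φ.comp ω (m + k) n :=
  seqComp_add _ _ _ _

theorem comp_congr {ω τ : ∀ n, I n} {n : ℕ} (h : ∀ i < n, ω i = τ i) :
    Φ.comp ω 0 n = Φ.comp τ 0 n :=
  seqComp_congr fun i hi => by simp [h i hi]

theorem comp_mapsTo (k n : ℕ) : MapsTo (Φ.comp ω k n) X X :=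
  seqComp_mapsTo (fun _ => Φ.mapsTo _ _) k n

theorem comp_mapsTo_domain (k n : ℕ) : MapsTo (Φ.comp ω k n) V V :=
  seqComp_mapsTo (fun _ => Φ.mapsTo_domain _ _) k n

theorem comp_injOn (k n : ℕ) : InjOn (Φ.comp ω k n) V :=
  seqComp_injOn (fun _ => Φ.mapsTo_domain _ _) (fun _ => Φ.injOn _ _) k n

theorem comp_conformalAt (k n : ℕ) {x : EuclideanSpace ℝ (Fin d)} (hx : x ∈ V) :
    ConformalAt (Φ.comp ω k n) x :=
  seqComp_conformalAt (fun _ => Φ.mapsTo_domain _ _) (fun _ => Φ.conformal _ _) k n x hx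

theorem comp_differentiableAt (k n : ℕ) {x : EuclideanSpace ℝ (Fin d)} (hx : x ∈ V) :
    DifferentiableAt ℝ (Φ.comp ω k n) x :=
  (Φ.comp_conformalAt ω k n hx).differentiableAt

theorem comp_continuousOn (k n : ℕ) : ContinuousOn (Φ.comp ω k n) V :=
  fun _ hx => (Φ.comp_differentiableAt ω k n hx).continuousAt.continuousWithinAt

/-- The scaling factor at `x` of a composition of maps of the system. -/
noncomputable def scale (k n : ℕ) (x : EuclideanSpace ℝ (Fin d)) : ℝ :=
  ‖fderiv ℝ (Φ.comp ω k n) x‖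

theorem scale_congr {ω τ : ∀ n, I n} {n : ℕ} (h : ∀ i < n, ω i = τ i) :
    Φ.scale ω 0 n = Φ.scale τ 0 n := by
  funext x
  rw [scale, Φ.comp_congr h, ← scale]

theorem scale_le_pow {m : ℕ} (hm : N ≤ m) (k : ℕ) {x : EuclideanSpace ℝ (Fin d)} (hx : x ∈ X) :
    Φ.scale ω k (m + 1) x ≤ η ^ m := by
  have := Φ.contraction m hm k (fun j => ω (j + k)) x hx
  rwa [wordMap_eq_comp] at this

section Nontrivial

variable [NeZero d]

@[simp]
theorem scale_zero (k : ℕ) (x : EuclideanSpace ℝ (Fin d)) : Φ.scale ω k 0 x = 1 := by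
  have : Nontrivial (EuclideanSpace ℝ (Fin d)) := inferInstance
  show ‖fderiv ℝ id x‖ = 1
  rw [fderiv_id]
  exact ContinuousLinearMap.norm_id

theorem scale_pos (k n : ℕ) {x : EuclideanSpace ℝ (Fin d)} (hx : x ∈ V) : 0 < Φ.scale ω k n x :=
  norm_fderiv_pos_of_conformalAt (Φ.comp_conformalAt ω k n hx)

theorem scale_add (k m n : ℕ) {x : EuclideanSpace ℝ (Fin d)} (hx : x ∈ V) :
    Φ.scale ω k (m + n) x = Φ.scale ω k m (Φ.comp ω (m + k) n x) * Φ.scale ω (m + k) n x := by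
  rw [scale, comp_add, norm_fderiv_comp_of_conformalAt _ (Φ.comp_conformalAt _ _ _ hx)]
  · rfl
  · exact Φ.comp_conformalAt _ _ _ (Φ.comp_mapsTo_domain _ _ _ hx)

theorem scale_succ (k n : ℕ) {x : EuclideanSpace ℝ (Fin d)} (hx : x ∈ V) :
    Φ.scale ω k (n + 1) x = Φ.scale ω k n (Φ.map (n + k) (ω (n + k)) x) *
      ‖fderiv ℝ (Φ.map (n + k) (ω (n + k))) x‖ := by
  rw [scale, comp_succ, norm_fderiv_comp_of_conformalAt _ (Φ.conformal _ _ _ hx)]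
  · rfl
  · exact Φ.comp_conformalAt _ _ _ (Φ.mapsTo_domain _ _ hx)

theorem scale_succ_left (k n : ℕ) {x : EuclideanSpace ℝ (Fin d)} (hx : x ∈ V) :
    Φ.scale ω k (n + 1) x = ‖fderiv ℝ (Φ.map k (ω k)) (Φ.comp ω (k + 1) n x)‖ *
      Φ.scale ω (k + 1) n x := by
  rw [scale, comp_succ_left, norm_fderiv_comp_of_conformalAt _ (Φ.comp_conformalAt _ _ _ hx)]
  · rfl
  · exact Φ.conformal _ _ _ (Φ.comp_mapsTo_domain _ _ _ hx)

theorem scale_le_mul_scale (hK : 1 ≤ K) (k n : ℕ) {x y : EuclideanSpace ℝ (Fin d)} (hx : x ∈ V)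
    (hy : y ∈ V) : Φ.scale ω k n x ≤ K * Φ.scale ω k n y := by
  cases n with
  | zero => simpa using hK
  | succ n =>
    have := Φ.distortion k n (fun j => ω (j + k)) x hx y hy
    rwa [wordMap_eq_comp] at this

theorem pos_of_word (Φ : NCIFS X V K η N I) (ω : ∀ n, I n) (hXne : X.Nonempty) (hXV : X ⊆ V) :
    0 < η := by
  obtain ⟨x, hx⟩ := hXne
  -- The exponent `2 * N + 1` exceeds `N` and is odd, so positivity of the power forces positivity
  -- of `η`.
  have h := (Φ.scale_pos ω 0 (2 * N + 1 + 1) (hXV hx)).trans_le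
    (Φ.scale_le_pow ω (m := 2 * N + 1) (by lia) 0 hx)
  exact (Odd.pow_pos_iff ⟨N, rfl⟩).1 h

theorem pow_le_scale {κ : ℝ} (hκ : 0 < κ) (hb : ∀ n a, ∀ x ∈ X, κ ≤ ‖fderiv ℝ (Φ.map n a) x‖)
    (hXV : X ⊆ V) (k n : ℕ) {x : EuclideanSpace ℝ (Fin d)} (hx : x ∈ X) :
    κ ^ n ≤ Φ.scale ω k n x := by
  induction n generalizing x with
  | zero => simp
  | succ n ih =>
    rw [Φ.scale_succ ω k n (hXV hx), pow_succ]
    exact mul_le_mul (ih (Φ.mapsTo _ _ hx)) (hb _ _ x hx) hκ.le (norm_nonneg _)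

/-- Uniform exponential contraction of all compositions on the whole domain. -/
theorem exists_scale_le (hb : Φ.DerivBoundedBelow) [∀ n, Nonempty (I n)] (hXne : X.Nonempty)
    (hXV : X ⊆ V) (hK : 1 ≤ K) :
    ∃ C : ℝ, 0 < C ∧ ∀ ω k n, ∀ x ∈ V, Φ.scale ω k n x ≤ C * η ^ n := by
  obtain ⟨κ, hκ, hb⟩ := hb
  have hη := Φ.pos_of_word (fun n => Classical.arbitrary (I n)) hXne hXV
  obtain ⟨x₀, hx₀⟩ := hXne
  refine ⟨K * η ^ N / κ ^ (N + 1), by positivity, fun ω k n x hx => ?_⟩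
  -- Contraction is assumed only for long words. Appending `N + 1` letters makes every word long
  -- enough, and their factor, at least `κ ^ (N + 1)`, is divided out.
  have h1 := Φ.scale_add ω k n (N + 1) (hXV hx₀)
  have h2 := Φ.scale_le_pow ω (m := n + N) (by lia) k hx₀
  have h3 := Φ.pow_le_scale ω hκ hb hXV (n + k) (N + 1) hx₀
  have h4 := Φ.scale_le_mul_scale ω hK k n hx (hXV (Φ.comp_mapsTo ω (n + k) (N + 1) hx₀))
  set q := Φ.scale ω k n (Φ.comp ω (n + k) (N + 1) x₀)
  have hq : 0 ≤ q := norm_nonneg _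
  have h5 : q * κ ^ (N + 1) ≤ η ^ (n + N) :=
    (mul_le_mul_of_nonneg_left h3 hq).trans (by rw [← h1]; exact h2)
  have h6 : q ≤ η ^ (n + N) / κ ^ (N + 1) := (le_div_iff₀ (by positivity)).2 h5
  calc Φ.scale ω k n x ≤ K * q := h4
    _ ≤ K * (η ^ (n + N) / κ ^ (N + 1)) := by gcongr
    _ = K * η ^ N / κ ^ (N + 1) * η ^ n := by rw [pow_add]; ring

/-- Compositions are Lipschitz on `X`, with constants comparable to their scaling factors. -/
theorem exists_norm_comp_sub_le (hXc : IsCompact X) (hVo : IsOpen V) (hVc : IsConnected V)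
    (hXV : X ⊆ V) (hK : 1 ≤ K) :
    ∃ C : ℝ, 0 < C ∧ ∀ (Φ : NCIFS X V K η N I) (ω : ∀ n, I n) (k n : ℕ), ∀ z ∈ V, ∀ x ∈ X, ∀ y ∈ X,
      ‖Φ.comp ω k n x - Φ.comp ω k n y‖ ≤ C * Φ.scale ω k n z * ‖x - y‖ := by
  obtain ⟨C, hC, h⟩ := hXc.exists_norm_sub_le_of_norm_fderiv_le
    (F := EuclideanSpace ℝ (Fin d)) hVo hVc.isPreconnected hXV
  refine ⟨C * K, by positivity, fun Φ ω k n z hz x hx y hy => ?_⟩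
  have := h (Φ.comp ω k n) (K * Φ.scale ω k n z)
    (mul_nonneg (by linarith) (norm_nonneg _))
    (fun x hx => Φ.comp_differentiableAt ω k n hx)
    (fun x hx => Φ.scale_le_mul_scale ω hK k n hx hz) x hx y hy
  linarith

end Nontrivial

end NCIFS

end NonAut

/-! ### Comparison of nearby systems, and volumes of disjoint cylinders -/

namespace NonAut

universe u

open Filter Topology Metric MeasureTheory
open scoped ENNReal NNReal

namespace NCIFS

variable {d : ℕ} {X V : Set (EuclideanSpace ℝ (Fin d))} {K η : ℝ} {N : ℕ} {I : ℕ → Type u}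

theorem norm_sub_le_of_edist_le {Φ Ψ : NCIFS X V K η N I} {δ : ℝ} (hδ : 0 ≤ δ)
    (h : edist Φ Ψ ≤ ENNReal.ofReal δ) (n : ℕ) (a : I n) {x : EuclideanSpace ℝ (Fin d)}
    (hx : x ∈ X) :
    ‖Φ.map n a x - Ψ.map n a x‖ ≤ δ ∧ ‖fderiv ℝ (Φ.map n a) x - fderiv ℝ (Ψ.map n a) x‖ ≤ δ := by
  have h1 : max (edist (Φ.map n a x) (Ψ.map n a x))
      (edist (fderiv ℝ (Φ.map n a) x) (fderiv ℝ (Ψ.map n a) x)) ≤ ENNReal.ofReal δ :=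
    (le_iSup_of_le n (le_iSup_of_le a (le_iSup (fun x : X =>
      max (edist (Φ.map n a x) (Ψ.map n a x))
        (edist (fderiv ℝ (Φ.map n a) x) (fderiv ℝ (Ψ.map n a) x))) ⟨x, hx⟩))).trans h
  rw [max_le_iff, edist_le_ofReal hδ, edist_le_ofReal hδ, dist_eq_norm, dist_eq_norm] at h1
  exact h1

/-- Replacing the maps of `Φ` by those of `Ψ` one at a time, the error `δ` made under `n` maps of
`Φ` shrinks to `A * η ^ n * δ`; the errors form a geometric series. -/
theorem norm_comp_sub_comp_le {Φ Ψ : NCIFS X V K η N I} {A δ : ℝ} (hA : 0 ≤ A) (hη : 0 ≤ η)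
    (hη1 : η < 1)
    (hlip : ∀ ω k n, ∀ x ∈ X, ∀ y ∈ X, ‖Φ.comp ω k n x - Φ.comp ω k n y‖ ≤ A * η ^ n * ‖x - y‖)
    (h : ∀ n a, ∀ x ∈ X, ‖Φ.map n a x - Ψ.map n a x‖ ≤ δ)
    (ω : ∀ n, I n) (k n : ℕ) {x : EuclideanSpace ℝ (Fin d)} (hx : x ∈ X) :
    ‖Φ.comp ω k n x - Ψ.comp ω k n x‖ * (1 - η) ≤ A * δ * (1 - η ^ n) := by
  induction n generalizing x with
  | zero => simp [comp, seqComp]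
  | succ n ih =>
    have h1 := hlip ω k n _ (Φ.mapsTo (n + k) (ω (n + k)) hx) _ (Ψ.mapsTo (n + k) (ω (n + k)) hx)
    have h2 := ih (Ψ.mapsTo (n + k) (ω (n + k)) hx)
    have h3 := norm_sub_le_norm_sub_add_norm_sub (Φ.comp ω k (n + 1) x)
      (Φ.comp ω k n (Ψ.map (n + k) (ω (n + k)) x)) (Ψ.comp ω k (n + 1) x)
    have h4 : ‖Φ.comp ω k (n + 1) x - Φ.comp ω k n (Ψ.map (n + k) (ω (n + k)) x)‖
        ≤ A * η ^ n * δ :=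
      h1.trans (mul_le_mul_of_nonneg_left (h _ _ x hx) (by positivity))
    calc _ ≤ (A * η ^ n * δ + ‖Φ.comp ω k n (Ψ.map (n + k) (ω (n + k)) x)
          - Ψ.comp ω k (n + 1) x‖) * (1 - η) :=
          mul_le_mul_of_nonneg_right (h3.trans (add_le_add_left h4 _)) (by linarith)
      _ ≤ A * η ^ n * δ * (1 - η) + A * δ * (1 - η ^ n) := by
          rw [add_mul]; exact add_le_add_right h2 _
      _ = A * δ * (1 - η ^ (n + 1)) := by ring

theorem scale_le_of_forall_step [NeZero d] {Φ Ψ : NCIFS X V K η N I} {c : ℝ} (hc : 0 ≤ c)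
    (hXV : X ⊆ V) (ω : ∀ n, I n)
    (h : ∀ k n, ∀ x ∈ X, ‖fderiv ℝ (Φ.map k (ω k)) (Φ.comp ω (k + 1) n x)‖
      ≤ c * ‖fderiv ℝ (Ψ.map k (ω k)) (Ψ.comp ω (k + 1) n x)‖)
    (k n : ℕ) {x : EuclideanSpace ℝ (Fin d)} (hx : x ∈ X) :
    Φ.scale ω k n x ≤ c ^ n * Ψ.scale ω k n x := by
  induction n generalizing k with
  | zero => simp
  | succ n ih =>
    rw [Φ.scale_succ_left ω k n (hXV hx), Ψ.scale_succ_left ω k n (hXV hx)]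
    calc _ ≤ (c * ‖fderiv ℝ (Ψ.map k (ω k)) (Ψ.comp ω (k + 1) n x)‖) *
          (c ^ n * Ψ.scale ω (k + 1) n x) :=
          mul_le_mul (h k n x hx) (ih _) (norm_nonneg _) (by positivity)
      _ = _ := by ring

/-- The central comparison: orbits stay close at all levels by contraction, so each one-letter
factor changes by a ratio at most `c`, and the chain rule multiplies these ratios. -/
theorem eventually_scale_le [NeZero d] [∀ n, Nonempty (I n)] (hXne : X.Nonempty)
    (hXc : IsCompact X) (hVo : IsOpen V) (hVc : IsConnected V) (hXV : X ⊆ V) (hK : 1 ≤ K)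
    (hη1 : η < 1) (Φ : Ku X V K η N I) {c : ℝ} (hc : 1 < c) :
    ∀ᶠ Ψ in 𝓝 Φ, ∀ ω n, ∀ x ∈ X, Ψ.1.scale ω 0 n x ≤ c ^ n * Φ.1.scale ω 0 n x ∧
      Φ.1.scale ω 0 n x ≤ c ^ n * Ψ.1.scale ω 0 n x := by
  obtain ⟨Φ, hb, huc⟩ := Φ
  obtain ⟨C, hC, hscale⟩ := Φ.exists_scale_le hb hXne hXV hK
  obtain ⟨B, hB, hlip⟩ := exists_norm_comp_sub_le (K := K) (η := η) (N := N) (I := I)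
    hXc hVo hVc hXV hK
  have hη := Φ.pos_of_word (fun n => Classical.arbitrary (I n)) hXne hXV
  obtain ⟨κ, hκ, hb⟩ := hb
  have hlip' : ∀ ω k n, ∀ x ∈ X, ∀ y ∈ X,
      ‖Φ.comp ω k n x - Φ.comp ω k n y‖ ≤ B * C * η ^ n * ‖x - y‖ := by
    intro ω k n x hx y hy
    refine (hlip Φ ω k n x (hXV hx) x hx y hy).trans ?_
    have := hscale ω k n x (hXV hx)
    rw [mul_assoc B C]
    gcongr
  have hc0 : 0 < c := by linarith
  -- Chosen so that `κ - ε = κ / c`: an additive error `ε` on a factor at least `κ` is a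
  -- multiplicative error at most `c`.
  set ε := κ * ((c - 1) / c) with hε
  have hεpos : 0 < ε := mul_pos hκ (div_pos (by linarith) hc0)
  obtain ⟨δ₀, hδ₀, huc⟩ := huc (ε / 2) (by positivity)
  have h1η : 0 < 1 - η := by linarith
  obtain ⟨δ, hδ, hδε, hδδ₀⟩ : ∃ δ > 0, δ ≤ ε / 2 ∧ B * C * δ / (1 - η) < δ₀ := by
    refine ⟨min (ε / 2) (δ₀ * (1 - η) / (2 * (B * C))), by positivity, min_le_left _ _, ?_⟩
    rw [div_lt_iff₀ h1η]
    calc _ ≤ B * C * (δ₀ * (1 - η) / (2 * (B * C))) := by gcongr; exact min_le_right _ _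
      _ = δ₀ * (1 - η) / 2 := by field_simp
      _ < _ := half_lt_self (by positivity)
  filter_upwards [eball_mem_nhds _ (ENNReal.ofReal_pos.2 hδ)] with Ψ hΨ
  obtain ⟨Ψ, hΨK⟩ := Ψ
  have hdist : edist Φ Ψ ≤ ENNReal.ofReal δ := by
    rw [edist_comm]; exact (mem_eball.1 hΨ).le
  have hclose := fun n a x hx => norm_sub_le_of_edist_le hδ.le hdist n a (x := x) hx
  have hstep : ∀ (ω : ∀ n, I n) k n, ∀ x ∈ X, |‖fderiv ℝ (Φ.map k (ω k)) (Φ.comp ω (k + 1) n x)‖ -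
      ‖fderiv ℝ (Ψ.map k (ω k)) (Ψ.comp ω (k + 1) n x)‖| ≤ ε := by
    intro ω k n x hx
    have hy := Φ.comp_mapsTo ω (k + 1) n hx
    have hz := Ψ.comp_mapsTo ω (k + 1) n hx
    have h1 := norm_comp_sub_comp_le (by positivity) hη.le hη1 hlip'
      (fun n a x hx => (hclose n a x hx).1) ω (k + 1) n hx
    have h2 : ‖Φ.comp ω (k + 1) n x - Ψ.comp ω (k + 1) n x‖ < δ₀ := by
      refine lt_of_le_of_lt ?_ hδδ₀
      rw [le_div_iff₀ h1η]
      refine h1.trans (mul_le_of_le_one_right (by positivity) ?_)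
      linarith [pow_pos hη n]
    have h3 := huc k (ω k) _ hy _ hz h2
    have h4 := (abs_norm_sub_norm_le _ _).trans ((hclose k (ω k) _ hz).2)
    -- First the base point moves with the map of `Φ` fixed (equicontinuity), then the map changes
    -- at a fixed point (uniform distance).
    calc _ ≤ _ := abs_sub_le _ (‖fderiv ℝ (Φ.map k (ω k)) (Ψ.comp ω (k + 1) n x)‖) _
      _ ≤ ε / 2 + ε / 2 := add_le_add h3.le (h4.trans hδε)
      _ = ε := by ring
  have hεκ : c * ε = κ * (c - 1) := by rw [hε]; field_simp
  intro ω n x hx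
  constructor
  · refine scale_le_of_forall_step hc0.le hXV ω (fun k n x hx => ?_) 0 n hx
    have h1 := (abs_le.1 (hstep ω k n x hx)).1
    have h2 := hb k (ω k) _ (Φ.comp_mapsTo ω (k + 1) n hx)
    have h3 : ε ≤ κ * (c - 1) := by nlinarith
    nlinarith
  · refine scale_le_of_forall_step hc0.le hXV ω (fun k n x hx => ?_) 0 n hx
    have h1 := (abs_le.1 (hstep ω k n x hx)).2
    have h2 := hb k (ω k) _ (Φ.comp_mapsTo ω (k + 1) n hx)
    nlinarith

/-- In finite dimension an injective derivative is surjective, so the map is open at each point of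
`interior X`. -/
theorem map_mapsTo_interior (Φ : NCIFS X V K η N I) (hVo : IsOpen V) (hXV : X ⊆ V) (n : ℕ)
    (a : I n) : MapsTo (Φ.map n a) (interior X) (interior X) := by
  intro x hx
  have hxV := hXV (interior_subset hx)
  have hs := ((Φ.contDiffOn n a).contDiffAt (hVo.mem_nhds hxV)).hasStrictFDerivAt one_ne_zero
  have hinj := (isConformalMap_fderiv (Φ.conformal n a x hxV)).injective
  have hsurj : (fderiv ℝ (Φ.map n a) x).range = ⊤ :=
    LinearMap.range_eq_top.2 (LinearMap.injective_iff_surjective.1 hinj)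
  have hmap := hs.map_nhds_eq_of_surj hsurj
  rw [mem_interior_iff_mem_nhds] at hx ⊢
  rw [← hmap]
  exact mem_map.2 (mem_of_superset hx fun y hy => Φ.mapsTo n a hy)

theorem comp_mapsTo_interior (Φ : NCIFS X V K η N I) (hVo : IsOpen V) (hXV : X ⊆ V)
    (ω : ∀ n, I n) (k n : ℕ) : MapsTo (Φ.comp ω k n) (interior X) (interior X) :=
  seqComp_mapsTo (fun _ => Φ.map_mapsTo_interior hVo hXV _ _) k n

/-- Injectivity on `V` cancels the common prefix, and the tails keep `interior X` inside itself, so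
the open set condition applies at the first differing letter. The two lengths may differ. -/
theorem disjoint_image_comp (Φ : NCIFS X V K η N I) (hVo : IsOpen V) (hXV : X ⊆ V)
    {ω τ : ∀ n, I n} {m n k : ℕ} (hm : k < m) (hn : k < n) (hlt : ∀ i < k, ω i = τ i)
    (hk : ω k ≠ τ k) :
    Disjoint (Φ.comp ω 0 m '' interior X) (Φ.comp τ 0 n '' interior X) := by
  obtain ⟨m, rfl⟩ := Nat.exists_eq_add_of_lt hm
  obtain ⟨n, rfl⟩ := Nat.exists_eq_add_of_lt hn
  have key : ∀ (ω : ∀ n, I n) m x, Φ.comp ω 0 (k + m + 1) x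
      = Φ.comp ω 0 k (Φ.map k (ω k) (Φ.comp ω (k + 1) m x)) := by
    intro ω m x
    rw [add_assoc, comp_add, Function.comp_apply, comp_succ_left]
    rfl
  rw [disjoint_left]
  rintro _ ⟨x, hx, rfl⟩ ⟨y, hy, hxy⟩
  rw [key, key, ← Φ.comp_congr hlt] at hxy
  have hx' := Φ.comp_mapsTo_interior hVo hXV ω (k + 1) m hx
  have hy' := Φ.comp_mapsTo_interior hVo hXV τ (k + 1) n hy
  have hV : ∀ z ∈ interior X, z ∈ V := fun z hz => hXV (interior_subset hz)
  have := Φ.comp_injOn ω 0 k (Φ.mapsTo_domain _ _ (hV _ hy')) (Φ.mapsTo_domain _ _ (hV _ hx')) hxy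
  exact disjoint_left.1 (Φ.openSet k _ _ hk) ⟨_, hx', rfl⟩ ⟨_, hy', this⟩

/-- Volume estimate for families of words with disjoint cylinders. -/
theorem tsum_one_mul_le_volume [NeZero d] (Φ : NCIFS X V K η N I) (hVo : IsOpen V)
    (hXV : X ⊆ V) (hK : 1 ≤ K) {ι : Type*} [Countable ι] (n : ι → ℕ) (ω : ι → ∀ n, I n)
    (hsep : Pairwise fun i j => ∃ k, k < n i ∧ k < n j ∧ (∀ l < k, ω i l = ω j l) ∧
      ω i k ≠ ω j k)
    {ρ : ℝ} (hρ : 0 < ρ) {z : EuclideanSpace ℝ (Fin d)} (hz : z ∈ V)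
    (hlow : ∀ i, ρ ≤ Φ.scale (ω i) 0 (n i) z) {B : Set (EuclideanSpace ℝ (Fin d))}
    (hB : ∀ i, Φ.comp (ω i) 0 (n i) '' X ⊆ B) :
    (∑' _ : ι, (1 : ℝ≥0∞)) * (ENNReal.ofReal ((ρ / K) ^ d) * volume (interior X)) ≤ volume B := by
  have hK0 : 0 < K := by linarith
  have hintV : interior X ⊆ V := interior_subset.trans hXV
  -- Change of variables: the Jacobian is the `d`-th power of the scaling factor, which distortion
  -- bounds below by `ρ / K`.
  have hvol : ∀ i, ENNReal.ofReal ((ρ / K) ^ d) * volume (interior X)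
      ≤ volume (Φ.comp (ω i) 0 (n i) '' interior X) := by
    intro i
    rw [← lintegral_abs_det_fderiv_eq_addHaar_image volume isOpen_interior.measurableSet
      (fun x hx => (Φ.comp_differentiableAt (ω i) 0 (n i) (hintV hx)).hasFDerivAt.hasFDerivWithinAt)
      ((Φ.comp_injOn (ω i) 0 (n i)).mono hintV), ← setLIntegral_const]
    refine setLIntegral_mono' isOpen_interior.measurableSet fun x hx => ?_
    rw [(isConformalMap_fderiv (Φ.comp_conformalAt (ω i) 0 (n i) (hintV hx))).abs_det,
      finrank_euclideanSpace_fin]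
    refine ENNReal.ofReal_le_ofReal (pow_le_pow_left₀ (by positivity) ?_ d)
    rw [div_le_iff₀ hK0, mul_comm]
    exact (hlow i).trans (Φ.scale_le_mul_scale (ω i) hK 0 (n i) hz (hintV hx))
  rw [← ENNReal.tsum_mul_right]
  simp only [one_mul]
  refine (ENNReal.tsum_le_tsum hvol).trans ?_
  refine (tsum_meas_le_meas_iUnion_of_disjoint volume (fun i => ?_) ?_).trans
    (measure_mono (iUnion_subset fun i => (image_mono interior_subset).trans (hB i)))
  · exact isOpen_interior.measurableSet.image_of_continuousOn_injOn
      ((Φ.comp_continuousOn _ _ _).mono hintV) ((Φ.comp_injOn _ _ _).mono hintV)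
  · intro i j hij
    obtain ⟨k, hki, hkj, hlt, hk⟩ := hsep hij
    exact Φ.disjoint_image_comp hVo hXV hki hkj hlt hk

end NCIFS

end NonAut

/-! ### Lower pressure: finiteness and continuity -/

namespace NonAut

universe u

open Filter Topology Metric MeasureTheory
open scoped ENNReal NNReal

namespace NCIFS

section Pressure

variable {d : ℕ} {X V : Set (EuclideanSpace ℝ (Fin d))} {K η : ℝ} {N : ℕ} {I : ℕ → Type u}
  [∀ n, Nonempty (I n)]

theorem derivNorm_eq_iSup_scale (Φ : NCIFS X V K η N I) (n : ℕ) (w : Word I 0 n) :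
    Φ.derivNorm n w = ⨆ x : X, Φ.scale w.extend 0 n x := by
  simp only [derivNorm, wordMap_eq_comp_extend, scale]

variable [NeZero d]

theorem exists_derivNorm_bounds (Φ : NCIFS X V K η N I) (hb : Φ.DerivBoundedBelow)
    (hXne : X.Nonempty) (hXV : X ⊆ V) (hK : 1 ≤ K) (hη : η < 1) :
    ∃ C κ : ℝ, 0 < C ∧ 0 < κ ∧ ∀ n (w : Word I 0 n), κ ^ n ≤ Φ.derivNorm n w ∧
      Φ.derivNorm n w ≤ C ∧ ∀ x ∈ X, Φ.scale w.extend 0 n x ≤ Φ.derivNorm n w := by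
  obtain ⟨C, hC, hscale⟩ := Φ.exists_scale_le hb hXne hXV hK
  have hη0 := Φ.pos_of_word (fun n => Classical.arbitrary (I n)) hXne hXV
  obtain ⟨κ, hκ, hb⟩ := hb
  refine ⟨C, κ, hC, hκ, fun n w => ?_⟩
  have hle : ∀ x ∈ X, Φ.scale w.extend 0 n x ≤ C := fun x hx =>
    (hscale _ _ _ x (hXV hx)).trans (mul_le_of_le_one_right hC.le (pow_le_one₀ hη0.le hη.le))
  -- A real supremum of an unbounded family defaults to `0`, so boundedness must come before any
  -- lower bound.
  have hbdd : BddAbove (range fun x : X => Φ.scale w.extend 0 n x) :=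
    ⟨C, by rintro _ ⟨x, rfl⟩; exact hle x x.2⟩
  have : Nonempty X := hXne.to_subtype
  rw [derivNorm_eq_iSup_scale]
  refine ⟨?_, ciSup_le fun x => hle x x.2, fun x hx => le_ciSup hbdd ⟨x, hx⟩⟩
  obtain ⟨x, hx⟩ := hXne
  exact (Φ.pow_le_scale _ hκ hb hXV 0 n hx).trans (le_ciSup hbdd ⟨x, hx⟩)

variable [∀ n, Fintype (I n)]

theorem partitionSum_pos (Φ : NCIFS X V K η N I) (hb : Φ.DerivBoundedBelow)
    (hXne : X.Nonempty) (hXV : X ⊆ V) (hK : 1 ≤ K) (hη : η < 1) (n : ℕ) (t : ℝ) :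
    0 < Φ.partitionSum n t := by
  obtain ⟨C, κ, hC, hκ, h⟩ := Φ.exists_derivNorm_bounds hb hXne hXV hK hη
  exact Finset.sum_pos (fun w _ => Real.rpow_pos_of_pos ((pow_pos hκ n).trans_le (h n w).1) t)
    Finset.univ_nonempty

/-- The number of words of length `n` grows at most exponentially. -/
theorem exists_card_word_le (Φ : NCIFS X V K η N I) (hb : Φ.DerivBoundedBelow)
    (hXne : X.Nonempty) (hXc : IsCompact X) (hXi : closure (interior X) = X) (hVo : IsOpen V)
    (hXV : X ⊆ V) (hK : 1 ≤ K) :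
    ∃ D A : ℝ, 1 ≤ D ∧ 0 < A ∧ ∀ n, (Fintype.card (Word I 0 n) : ℝ) ≤ D * A ^ n := by
  obtain ⟨κ, hκ, hb⟩ := hb
  obtain ⟨x₀, hx₀⟩ := hXne
  have hK0 : 0 < K := by linarith
  have hint : (interior X).Nonempty := by
    rw [← closure_nonempty_iff, hXi]; exact ⟨x₀, hx₀⟩
  have hv0 : 0 < volume.real (interior X) := by
    refine ENNReal.toReal_pos (isOpen_interior.measure_pos volume hint).ne' ?_
    exact ((measure_mono interior_subset).trans_lt hXc.measure_lt_top).ne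
  -- Disjoint cylinders of volume at least `(κ ^ n / K) ^ d * volume (interior X)` fit into `X`; the
  -- `1` keeps `D` positive.
  refine ⟨max 1 (volume.real X * K ^ d / volume.real (interior X)), (κ ^ d)⁻¹, le_max_left _ _,
    by positivity, fun n => ?_⟩
  have h := Φ.tsum_one_mul_le_volume hVo hXV hK (ι := Word I 0 n) (fun _ => n)
    (fun w => w.extend) (fun v w hvw => ?_) (pow_pos hκ n) (hXV hx₀)
    (fun w => Φ.pow_le_scale _ hκ hb hXV 0 n hx₀) (B := X)
    (fun w => (Φ.comp_mapsTo _ 0 n).image_subset)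
  · rw [tsum_fintype, Finset.sum_const, Finset.card_univ, nsmul_eq_mul, mul_one] at h
    have h' := ENNReal.toReal_mono hXc.measure_lt_top.ne h
    rw [ENNReal.toReal_mul, ENNReal.toReal_mul, ENNReal.toReal_natCast,
      ENNReal.toReal_ofReal (by positivity)] at h'
    change _ * (_ * volume.real (interior X)) ≤ volume.real X at h'
    calc (Fintype.card (Word I 0 n) : ℝ)
        = (Fintype.card (Word I 0 n) * ((κ ^ n / K) ^ d * volume.real (interior X))) *
          (K ^ d / volume.real (interior X) * (κ ^ d)⁻¹ ^ n) := by
          rw [div_pow, ← pow_mul, inv_pow, ← pow_mul, mul_comm n d]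
          field_simp
      _ ≤ volume.real X * (K ^ d / volume.real (interior X) * (κ ^ d)⁻¹ ^ n) := by gcongr
      _ = volume.real X * K ^ d / volume.real (interior X) * (κ ^ d)⁻¹ ^ n := by ring
      _ ≤ _ := by gcongr; exact le_max_right _ _
  · by_contra hcon
    apply hvw
    push Not at hcon
    have hall : ∀ k, k < n → v.extend k = w.extend k := by
      intro k
      induction k using Nat.strong_induction_on with
      | _ k ih => exact fun hk => hcon k hk hk fun l hl => ih l hl (hl.trans hk)
    funext j
    have := hall j j.2
    rwa [Word.extend_apply, Word.extend_apply] at this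

theorem exists_pressure_bounds (Φ : NCIFS X V K η N I) (hb : Φ.DerivBoundedBelow)
    (hXne : X.Nonempty) (hXc : IsCompact X) (hXi : closure (interior X) = X) (hVo : IsOpen V)
    (hXV : X ⊆ V) (hK : 1 ≤ K) (hη : η < 1) {t : ℝ} (ht : 0 ≤ t) :
    ∃ a b : ℝ, ∀ n : ℕ, 1 ≤ n → a ≤ 1 / (n : ℝ) * Real.log (Φ.partitionSum n t) ∧
      1 / (n : ℝ) * Real.log (Φ.partitionSum n t) ≤ b := by
  obtain ⟨C, κ, hC, hκ, h⟩ := Φ.exists_derivNorm_bounds hb hXne hXV hK hη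
  obtain ⟨D, A, hD, hA, hcard⟩ := Φ.exists_card_word_le hb hXne hXc hXi hVo hXV hK
  -- A single word gives the lower bound, the word count the upper one. The absolute value absorbs
  -- the factor `1 / n ≤ 1` in front of `log (D * C ^ t)`.
  refine ⟨t * Real.log κ, |Real.log (D * C ^ t)| + Real.log A, fun n hn => ?_⟩
  have hn' : (1 : ℝ) ≤ n := by exact_mod_cast hn
  have hn0 : (0 : ℝ) < n := by linarith
  have hZ := Φ.partitionSum_pos hb hXne hXV hK hη n t
  have hlow : (κ ^ n) ^ t ≤ Φ.partitionSum n t := by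
    let w : Word I 0 n := Classical.arbitrary _
    refine le_trans ?_ (Finset.single_le_sum (f := fun w => Φ.derivNorm n w ^ t)
      (fun w _ => Real.rpow_nonneg ((pow_pos hκ n).le.trans (h n w).1) t) (Finset.mem_univ w))
    exact Real.rpow_le_rpow (pow_pos hκ n).le (h n w).1 ht
  have hup : Φ.partitionSum n t ≤ (D * C ^ t) * A ^ n := by
    calc Φ.partitionSum n t ≤ ∑ _w : Word I 0 n, C ^ t :=
          Finset.sum_le_sum fun w _ =>
            Real.rpow_le_rpow ((pow_pos hκ n).le.trans (h n w).1) (h n w).2.1 ht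
      _ = Fintype.card (Word I 0 n) * C ^ t := by simp
      _ ≤ D * A ^ n * C ^ t := by gcongr; exact hcard n
      _ = _ := by ring
  have hDC : 0 < D * C ^ t := by positivity
  constructor
  · rw [one_div, ← div_eq_inv_mul, le_div_iff₀ hn0]
    have := Real.log_le_log (by positivity) hlow
    rw [Real.log_rpow (by positivity), Real.log_pow] at this
    linarith
  · rw [one_div, ← div_eq_inv_mul, div_le_iff₀ hn0]
    have := Real.log_le_log hZ hup
    rw [Real.log_mul hDC.ne' (by positivity), Real.log_pow] at this
    have h1 := le_abs_self (Real.log (D * C ^ t))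
    nlinarith [abs_nonneg (Real.log (D * C ^ t))]

theorem lowerPressure_ne_bot_and_ne_top (Φ : NCIFS X V K η N I) (hb : Φ.DerivBoundedBelow)
    (hXne : X.Nonempty) (hXc : IsCompact X) (hXi : closure (interior X) = X) (hVo : IsOpen V)
    (hXV : X ⊆ V) (hK : 1 ≤ K) (hη : η < 1) {t : ℝ} (ht : 0 ≤ t) :
    Φ.lowerPressure t ≠ ⊥ ∧ Φ.lowerPressure t ≠ ⊤ := by
  obtain ⟨a, b, h⟩ := Φ.exists_pressure_bounds hb hXne hXc hXi hVo hXV hK hη ht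
  constructor
  · refine ((EReal.bot_lt_coe a).trans_le ?_).ne'
    refine (liminf_const (f := atTop (α := ℕ)) (a : EReal)).symm.le.trans (liminf_le_liminf ?_)
    filter_upwards [eventually_ge_atTop 1] with n hn
    exact EReal.coe_le_coe_iff.2 (h n hn).1
  · refine (lt_of_le_of_lt ?_ (EReal.coe_lt_top b)).ne
    refine (liminf_le_liminf ?_).trans (liminf_const (f := atTop (α := ℕ)) (b : EReal)).le
    filter_upwards [eventually_ge_atTop 1] with n hn
    exact EReal.coe_le_coe_iff.2 (h n hn).2

theorem lowerPressure_le_add {Φ Ψ : NCIFS X V K η N I} (hΦ : Φ.DerivBoundedBelow)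
    (hΨ : Ψ.DerivBoundedBelow) (hXne : X.Nonempty) (hXV : X ⊆ V) (hK : 1 ≤ K) (hη : η < 1)
    {t : ℝ} (ht : 0 ≤ t) {c : ℝ} (hc : 1 < c)
    (h : ∀ ω n, ∀ x ∈ X, Ψ.scale ω 0 n x ≤ c ^ n * Φ.scale ω 0 n x) :
    Ψ.lowerPressure t ≤ ((t * Real.log c : ℝ) : EReal) + Φ.lowerPressure t := by
  obtain ⟨C, κ, hC, hκ, hΦn⟩ := Φ.exists_derivNorm_bounds hΦ hXne hXV hK hη
  obtain ⟨C', κ', hC', hκ', hΨn⟩ := Ψ.exists_derivNorm_bounds hΨ hXne hXV hK hη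
  have hc0 : 0 < c := by linarith
  have : Nonempty X := hXne.to_subtype
  have hZ : ∀ n, Ψ.partitionSum n t ≤ (c ^ n) ^ t * Φ.partitionSum n t := by
    intro n
    rw [partitionSum, partitionSum, Finset.mul_sum]
    refine Finset.sum_le_sum fun w _ => ?_
    rw [← Real.mul_rpow (by positivity) ((pow_pos hκ n).le.trans (hΦn n w).1)]
    refine Real.rpow_le_rpow ((pow_pos hκ' n).le.trans (hΨn n w).1) ?_ ht
    rw [derivNorm_eq_iSup_scale Ψ]
    exact ciSup_le fun x => (h _ n x x.2).trans
      (mul_le_mul_of_nonneg_left ((hΦn n w).2.2 x x.2) (by positivity))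
  have hle : ∀ᶠ n : ℕ in atTop,
      ((1 / (n : ℝ) * Real.log (Ψ.partitionSum n t) : ℝ) : EReal) ≤
      ((t * Real.log c : ℝ) : EReal) + ((1 / (n : ℝ) * Real.log (Φ.partitionSum n t) : ℝ) : EReal) := by
    filter_upwards [eventually_ge_atTop 1] with n hn
    have hn0 : (0 : ℝ) < n := by exact_mod_cast hn
    rw [← EReal.coe_add, EReal.coe_le_coe_iff]
    have h1 := Real.log_le_log (Ψ.partitionSum_pos hΨ hXne hXV hK hη n t) (hZ n)
    rw [Real.log_mul (by positivity) (Φ.partitionSum_pos hΦ hXne hXV hK hη n t).ne',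
      Real.log_rpow (by positivity), Real.log_pow] at h1
    calc _ ≤ 1 / (n : ℝ) * (t * (n * Real.log c) + Real.log (Φ.partitionSum n t)) := by gcongr
      _ = _ := by field_simp
  refine (liminf_le_liminf hle).trans ?_
  have h2 := EReal.liminf_add_le (f := atTop (α := ℕ))
    (u := fun _ => ((t * Real.log c : ℝ) : EReal))
    (v := fun n : ℕ => ((1 / (n : ℝ) * Real.log (Φ.partitionSum n t) : ℝ) : EReal))
    (Or.inl (by rw [limsup_const]; exact EReal.coe_ne_bot _))
    (Or.inl (by rw [limsup_const]; exact EReal.coe_ne_top _))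
  rw [limsup_const] at h2
  exact h2

theorem continuous_lowerPressure (hXne : X.Nonempty) (hXc : IsCompact X)
    (hXi : closure (interior X) = X) (hVo : IsOpen V) (hVc : IsConnected V)
    (hXV : X ⊆ V) (hK : 1 ≤ K) (hη : η < 1) {t : ℝ} (ht : 0 ≤ t) :
    Continuous fun Ψ : Ku X V K η N I => Ψ.1.lowerPressure t := by
  have hfin := fun Ψ : Ku X V K η N I =>
    Ψ.1.lowerPressure_ne_bot_and_ne_top Ψ.2.1 hXne hXc hXi hVo hXV hK hη ht
  have hcoe : ∀ Ψ : Ku X V K η N I, ((Ψ.1.lowerPressure t).toReal : EReal) = Ψ.1.lowerPressure t :=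
    fun Ψ => EReal.coe_toReal (hfin Ψ).2 (hfin Ψ).1
  suffices h : Continuous fun Ψ : Ku X V K η N I => (Ψ.1.lowerPressure t).toReal by
    simpa only [Function.comp_def, hcoe] using continuous_coe_real_ereal.comp h
  refine continuous_iff_continuousAt.2 fun Φ => Metric.tendsto_nhds.2 fun ε hε => ?_
  -- This makes `t * log c < ε`; the `t + 1` allows `t = 0`.
  have hc : 1 < Real.exp (ε / (t + 1)) := Real.one_lt_exp_iff.2 (by positivity)
  filter_upwards [eventually_scale_le hXne hXc hVo hVc hXV hK hη Φ hc] with Ψ h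
  have h1 := lowerPressure_le_add Φ.2.1 Ψ.2.1 hXne hXV hK hη ht hc fun ω n x hx => (h ω n x hx).1
  have h2 := lowerPressure_le_add Ψ.2.1 Φ.2.1 hXne hXV hK hη ht hc fun ω n x hx => (h ω n x hx).2
  rw [← hcoe Φ, ← hcoe Ψ, ← EReal.coe_add, EReal.coe_le_coe_iff, Real.log_exp] at h1 h2
  have h3 : t * (ε / (t + 1)) < ε := by
    rw [mul_div_assoc', div_lt_iff₀ (by positivity)]
    nlinarith
  rw [Real.dist_eq, abs_lt]
  constructor <;> linarith

end Pressure

end NCIFS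

end NonAut

/-! ### Limit sets and Hausdorff dimension -/

namespace NonAut

universe u

open Filter Topology Metric MeasureTheory
open scoped ENNReal NNReal

namespace NCIFS

section Dimension

variable {d : ℕ} {X V : Set (EuclideanSpace ℝ (Fin d))} {K η : ℝ} {N : ℕ} {I : ℕ → Type u}

theorem comp_image_antitone (Φ : NCIFS X V K η N I) (ω : ∀ n, I n) :
    Antitone fun n => Φ.comp ω 0 n '' X := by
  refine antitone_nat_of_succ_le fun n => ?_
  simp only [comp_succ, image_comp]
  exact image_mono (Φ.mapsTo _ _).image_subset

theorem mem_limitSet_of_forall_mem (Φ : NCIFS X V K η N I) (ω : ∀ n, I n)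
    {y : EuclideanSpace ℝ (Fin d)} (hy : ∀ n, y ∈ Φ.comp ω 0 n '' X) : y ∈ Φ.limitSet := by
  simp only [limitSet, mem_iInter, mem_iUnion]
  intro n _
  refine ⟨fun j => ω (j + 0), ?_⟩
  rw [wordMap_eq_comp]
  exact hy n

theorem exists_forall_mem_comp_image (Φ : NCIFS X V K η N I) (hXne : X.Nonempty)
    (hXc : IsCompact X) (hXV : X ⊆ V) (ω : ∀ n, I n) : ∃ y, ∀ n, y ∈ Φ.comp ω 0 n '' X := by
  have hc : ∀ n, IsCompact (Φ.comp ω 0 n '' X) := fun n =>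
    hXc.image_of_continuousOn ((Φ.comp_continuousOn ω 0 n).mono hXV)
  obtain ⟨y, hy⟩ := IsCompact.nonempty_iInter_of_sequence_nonempty_isCompact_isClosed
    (fun n => Φ.comp ω 0 n '' X) (fun n => Φ.comp_image_antitone ω n.le_succ)
    (fun n => hXne.image _) (hc 0) (fun n => (hc n).isClosed)
  exact ⟨y, fun n => mem_iInter.1 hy n⟩

/-- König's lemma: codes form a compact product of finite discrete spaces, and the admissible codes
at each level form decreasing nonempty closed sets. -/
theorem exists_coding_of_mem_limitSet [∀ n, Fintype (I n)] [∀ n, Nonempty (I n)]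
    (Φ : NCIFS X V K η N I) {y : EuclideanSpace ℝ (Fin d)} (hy : y ∈ Φ.limitSet) :
    ∃ ω : ∀ n, I n, ∀ n, y ∈ Φ.comp ω 0 n '' X := by
  let _ : ∀ n, TopologicalSpace (I n) := fun _ => ⊥
  have : ∀ n, DiscreteTopology (I n) := fun _ => ⟨rfl⟩
  let S : ℕ → Set (∀ n, I n) := fun n => {ω | y ∈ Φ.comp ω 0 n '' X}
  have hSclosed : ∀ n, IsClosed (S n) := by
    intro n
    have h : S n = (fun (ω : ∀ n, I n) (j : Fin n) => ω ((j : ℕ) + 0)) ⁻¹'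
        {w : Word I 0 n | y ∈ wordMap Φ.map 0 n w '' X} := by
      ext ω
      simp only [S, mem_ofPred_eq, mem_preimage, wordMap_eq_comp]
    rw [h]
    exact (isClosed_discrete _).preimage (continuous_pi fun j => continuous_apply _)
  have hanti : ∀ n, S (n + 1) ⊆ S n := fun n ω hω => Φ.comp_image_antitone ω n.le_succ hω
  have hpos : ∀ n, (S (n + 1)).Nonempty := by
    intro n
    simp only [limitSet, mem_iInter, mem_iUnion] at hy
    obtain ⟨w, hw⟩ := hy (n + 1) (by lia)
    rw [wordMap_eq_comp_extend] at hw
    exact ⟨w.extend, hw⟩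
  obtain ⟨ω, hω⟩ := IsCompact.nonempty_iInter_of_sequence_nonempty_isCompact_isClosed S hanti
    (fun n => (hpos n).mono (hanti n)) (hSclosed 0).isCompact hSclosed
  exact ⟨ω, fun n => mem_iInter.1 hω n⟩

theorem sigma_word_ext_iff {p q : Σ n, Word I 0 n} :
    p = q ↔ p.1 = q.1 ∧ ∀ i (hp : i < p.1) (hq : i < q.1), p.2 ⟨i, hp⟩ = q.2 ⟨i, hq⟩ := by
  obtain ⟨m, v⟩ := p
  obtain ⟨n, w⟩ := q
  constructor
  · intro h
    cases h
    exact ⟨rfl, fun i _ _ => rfl⟩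
  · rintro ⟨h, h'⟩
    change m = n at h
    subst h
    congr 1
    funext j
    exact h' j j.2 j.2

variable [NeZero d]

/-- The words stopped when the scaling factor drops below `r`, with cylinder meeting a given ball of
radius `r`: their number is bounded, and the cylinders of a comparable system along the same words
cover all points whose codes lead into the ball. -/
theorem exists_cover_of_closedBall [∀ n, Finite (I n)] [∀ n, Nonempty (I n)]
    {Φ Ψ : NCIFS X V K η N I} (hb : Φ.DerivBoundedBelow)
    (hXne : X.Nonempty) (hXc : IsCompact X) (hXi : closure (interior X) = X) (hVo : IsOpen V)
    (hVc : IsConnected V) (hXV : X ⊆ V) (hK : 1 ≤ K) (hη : η < 1) {θ : ℝ} (hθ : 0 < θ)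
    (h : ∀ ω n, ∀ x ∈ X, Ψ.scale ω 0 n x ≤ (η ^ (-θ)) ^ n * Φ.scale ω 0 n x) :
    ∃ (M : ℝ≥0∞) (A : ℝ), M ≠ ∞ ∧ 0 ≤ A ∧ ∀ (x : EuclideanSpace ℝ (Fin d)) (r : ℝ), 0 < r → r < 1 →
      ∃ (ι : Type u) (_ : Countable ι) (t : ι → Set (EuclideanSpace ℝ (Fin d))),
        (∑' _ : ι, (1 : ℝ≥0∞)) ≤ M ∧ (∀ i, ediam (t i) ≤ ENNReal.ofReal (A * r ^ (1 - θ))) ∧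
        ∀ (ω : ∀ n, I n) (y z : EuclideanSpace ℝ (Fin d)), y ∈ closedBall x r →
          (∀ n, y ∈ Φ.comp ω 0 n '' X) → (∀ n, z ∈ Ψ.comp ω 0 n '' X) → z ∈ ⋃ i, t i := by
  classical
  obtain ⟨C, hC, hscale⟩ := Φ.exists_scale_le hb hXne hXV hK
  obtain ⟨B, hB, hlip⟩ := exists_norm_comp_sub_le (K := K) (η := η) (N := N) (I := I)
    hXc hVo hVc hXV hK
  have hη0 := Φ.pos_of_word (fun n => Classical.arbitrary (I n)) hXne hXV
  obtain ⟨κ, hκ, hb⟩ := hb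
  have hK0 : 0 < K := by linarith
  obtain ⟨z₀, hz₀⟩ := hXne
  have hz₀V := hXV hz₀
  obtain ⟨R, hR, hXR⟩ : ∃ R : ℝ, 0 < R ∧ ∀ x ∈ X, ∀ y ∈ X, ‖x - y‖ ≤ R := by
    obtain ⟨R, hR⟩ := isBounded_iff.1 hXc.isBounded
    refine ⟨max R 1, by positivity, fun x hx y hy => ?_⟩
    rw [← dist_eq_norm]
    exact (hR hx hy).trans (le_max_left _ _)
  have hint : (interior X).Nonempty := by
    rw [← closure_nonempty_iff, hXi]; exact ⟨z₀, hz₀⟩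
  have hv0 : volume (interior X) ≠ 0 := (isOpen_interior.measure_pos volume hint).ne'
  have hvt : volume (interior X) ≠ ∞ :=
    ((measure_mono interior_subset).trans_lt hXc.measure_lt_top).ne
  have hreach : ∀ (r : ℝ), 0 < r → ∀ ω, ∃ n, Φ.scale ω 0 n z₀ ≤ r := by
    intro r hr ω
    obtain ⟨n, hn⟩ := exists_pow_lt_of_lt_one (div_pos hr hC) hη
    refine ⟨n, (hscale ω 0 n z₀ hz₀V).trans ?_⟩
    rw [lt_div_iff₀ hC] at hn
    linarith
  have ha : 0 < (κ / K / K) ^ d := by positivity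
  -- `M` is the volume of a ball of radius `(1 + B * R) * r` over the least volume of a stopped
  -- cylinder; the factor `r ^ d` cancels.
  refine ⟨ENNReal.ofReal ((1 + B * R) ^ d) * volume (ball (0 : EuclideanSpace ℝ (Fin d)) 1) /
    (ENNReal.ofReal ((κ / K / K) ^ d) * volume (interior X)),
    B * R * (κ / K / C) ^ (-θ), ?_, by positivity, fun x r hr hr1 => ?_⟩
  · refine ENNReal.div_ne_top (ENNReal.mul_ne_top ENNReal.ofReal_ne_top measure_ball_lt_top.ne) ?_
    exact mul_ne_zero (ENNReal.ofReal_pos.2 ha).ne' hv0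
  let ν : (∀ n, I n) → ℕ := fun ω => Nat.find (hreach r hr ω)
  have hν : ∀ ω, Φ.scale ω 0 (ν ω) z₀ ≤ r := fun ω => Nat.find_spec (hreach r hr ω)
  have hνmin : ∀ ω m, m < ν ω → r < Φ.scale ω 0 m z₀ := fun ω m hm =>
    not_le.1 (Nat.find_min (hreach r hr ω) hm)
  have hνle : ∀ ω τ, (∀ i < ν ω, ω i = τ i) → ν τ ≤ ν ω := fun ω τ h' =>
    Nat.find_min' (hreach r hr τ) (by rw [← Φ.scale_congr h']; exact hν ω)
  -- Since `r < 1`, stopping needs at least one letter. Before the last letter the scale exceeded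
  -- `r`; that letter costs a factor `κ` and distortion a factor `K`.
  have hνlow : ∀ ω, κ / K * r ≤ Φ.scale ω 0 (ν ω) z₀ := by
    intro ω
    obtain ⟨m, hm⟩ : ∃ m, ν ω = m + 1 := by
      refine Nat.exists_eq_succ_of_ne_zero fun h0 => ?_
      have := hν ω
      rw [h0, scale_zero] at this
      linarith
    have h1 := (hνmin ω m (by lia)).le.trans
      (Φ.scale_le_mul_scale ω hK 0 m hz₀V (Φ.mapsTo_domain (m + 0) (ω (m + 0)) hz₀V))
    have h2 := hb (m + 0) (ω (m + 0)) z₀ hz₀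
    rw [hm, Φ.scale_succ ω 0 m hz₀V, div_mul_eq_mul_div, div_le_iff₀ hK0]
    calc κ * r ≤ ‖fderiv ℝ (Φ.map (m + 0) (ω (m + 0))) z₀‖ *
          (K * Φ.scale ω 0 m (Φ.map (m + 0) (ω (m + 0)) z₀)) :=
          mul_le_mul h2 h1 hr.le (norm_nonneg _)
      _ = _ := by ring
  have hρ : 0 < κ / K * r := by positivity
  let p : (∀ n, I n) → Σ n, Word I 0 n := fun ω => ⟨ν ω, fun j => ω (j : ℕ)⟩
  let T : Set (∀ n, I n) := {ω | (Φ.comp ω 0 (ν ω) '' X ∩ closedBall x r).Nonempty}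
  have hrep : ∀ i : p '' T, ∃ ω ∈ T, p ω = i := fun i => i.2
  choose rep hrepT hrep using hrep
  have hpeq : ∀ ω τ, p ω = p τ → ν ω = ν τ ∧ ∀ i < ν ω, ω i = τ i := by
    intro ω τ hp
    rw [sigma_word_ext_iff] at hp
    exact ⟨hp.1, fun i hi => hp.2 i hi (hi.trans_eq hp.1)⟩
  refine ⟨p '' T, inferInstance, fun i => Ψ.comp (rep i) 0 (ν (rep i)) '' X, ?_, ?_, ?_⟩
  · have hpack := Φ.tsum_one_mul_le_volume hVo hXV hK (ι := p '' T) (fun i => ν (rep i)) rep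
      (fun i j hij => ?_) hρ hz₀V (fun i => hνlow _) (B := closedBall x ((1 + B * R) * r))
      (fun i => ?_)
    · rw [Measure.addHaar_closedBall volume x (by positivity), finrank_euclideanSpace_fin,
        show κ / K * r / K = κ / K / K * r by ring, mul_pow, mul_pow,
        ENNReal.ofReal_mul (by positivity), ENNReal.ofReal_mul (by positivity)] at hpack
      have hr0 : ENNReal.ofReal (r ^ d) ≠ 0 := (ENNReal.ofReal_pos.2 (by positivity)).ne'
      rw [ENNReal.le_div_iff_mul_le (Or.inl (mul_ne_zero (ENNReal.ofReal_pos.2 ha).ne' hv0))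
        (Or.inl (ENNReal.mul_ne_top ENNReal.ofReal_ne_top hvt)),
        ← ENNReal.mul_le_mul_iff_right hr0 ENNReal.ofReal_ne_top]
      calc _ = _ := by ring
        _ ≤ _ := hpack
        _ = _ := by ring
    · by_contra hcon
      push Not at hcon
      have hall : ∀ k, k < ν (rep i) → k < ν (rep j) → rep i k = rep j k := by
        intro k
        induction k using Nat.strong_induction_on with
        | _ k ih =>
          intro hki hkj
          exact hcon k hki hkj fun l hl => ih l hl (hl.trans hki) (hl.trans hkj)
      -- Stopping depends only on the letters already read, so no stopped word is a proper prefix of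
      -- another.
      have hνeq : ν (rep i) = ν (rep j) := by
        rcases le_total (ν (rep i)) (ν (rep j)) with hle | hle
        · exact le_antisymm hle (hνle _ _ fun k hk => hall k hk (hk.trans_le hle))
        · exact le_antisymm (hνle _ _ fun k hk => (hall k (hk.trans_le hle) hk).symm) hle
      apply hij
      rw [← Subtype.coe_inj, ← hrep i, ← hrep j, sigma_word_ext_iff]
      exact ⟨hνeq, fun k hki hkj => hall k hki hkj⟩
    · obtain ⟨_, ⟨a, ha, rfl⟩, hax⟩ := hrepT i
      rintro _ ⟨b, hb', rfl⟩
      have h1 := hlip Φ (rep i) 0 (ν (rep i)) z₀ hz₀V b hb' a ha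
      have h2 := hXR b hb' a ha
      have h3 := hν (rep i)
      have h4 : B * Φ.scale (rep i) 0 (ν (rep i)) z₀ * ‖b - a‖ ≤ B * r * R := by gcongr
      rw [mem_closedBall] at hax ⊢
      calc _ ≤ _ := dist_triangle _ (Φ.comp (rep i) 0 (ν (rep i)) a) _
        _ ≤ B * r * R + r := by rw [dist_eq_norm]; exact add_le_add (h1.trans h4) hax
        _ = _ := by ring
  · intro i
    set ω := rep i
    -- The lower bound on the stopped scale and its upper bound `C * η ^ n` bound `η ^ n` below by a
    -- multiple of `r`.
    have hpow : (η ^ (-θ)) ^ ν ω ≤ (κ / K / C * r) ^ (-θ) := by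
      rw [← Real.rpow_natCast, ← Real.rpow_mul hη0.le, mul_comm, Real.rpow_mul hη0.le,
        Real.rpow_natCast]
      refine Real.rpow_le_rpow_of_nonpos (by positivity) ?_ (by linarith)
      have := (hνlow ω).trans (hscale ω 0 (ν ω) z₀ hz₀V)
      rw [div_mul_eq_mul_div, div_le_iff₀ hC]
      linarith
    have hΨ : Ψ.scale ω 0 (ν ω) z₀ ≤ (κ / K / C) ^ (-θ) * r ^ (1 - θ) := by
      calc _ ≤ _ := h ω (ν ω) z₀ hz₀
        _ ≤ (κ / K / C * r) ^ (-θ) * r := by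
          exact mul_le_mul hpow (hν ω) (norm_nonneg _) (by positivity)
        _ = _ := by
          rw [Real.mul_rpow (by positivity) hr.le, sub_eq_neg_add, Real.rpow_add hr, Real.rpow_one]
          ring
    refine ediam_le ?_
    rintro _ ⟨a, ha, rfl⟩ _ ⟨b, hb', rfl⟩
    rw [edist_le_ofReal (by positivity), dist_eq_norm]
    calc _ ≤ _ := hlip Ψ ω 0 (ν ω) z₀ hz₀V a ha b hb'
      _ ≤ B * ((κ / K / C) ^ (-θ) * r ^ (1 - θ)) * R := by
        gcongr
        exact hXR a ha b hb'
      _ = _ := by ring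
  · intro ω y z hyx hy hz
    have hωT : ω ∈ T := ⟨y, hy _, hyx⟩
    refine mem_iUnion.2 ⟨⟨p ω, ω, hωT, rfl⟩, ?_⟩
    obtain ⟨h1, h2⟩ := hpeq _ _ (hrep ⟨p ω, ω, hωT, rfl⟩)
    rw [Ψ.comp_congr h2, h1]
    exact hz _

/-- Equality of codes relates the limit sets like a Hölder map of exponent `1 - θ`. Codes need not
be unique, so covers are transferred instead of points. -/
theorem ofReal_mul_dimH_limitSet_le [∀ n, Fintype (I n)] [∀ n, Nonempty (I n)]
    {Φ Ψ : NCIFS X V K η N I} (hb : Φ.DerivBoundedBelow)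
    (hXne : X.Nonempty) (hXc : IsCompact X) (hXi : closure (interior X) = X) (hVo : IsOpen V)
    (hVc : IsConnected V) (hXV : X ⊆ V) (hK : 1 ≤ K) (hη : η < 1) {θ : ℝ} (hθ : 0 < θ)
    (hθ1 : θ < 1)
    (h : ∀ ω n, ∀ x ∈ X, Ψ.scale ω 0 n x ≤ (η ^ (-θ)) ^ n * Φ.scale ω 0 n x) :
    ENNReal.ofReal (1 - θ) * dimH Ψ.limitSet ≤ dimH Φ.limitSet := by
  obtain ⟨M, A, hM, hA, hcover⟩ := exists_cover_of_closedBall hb hXne hXc hXi hVo hVc hXV hK hη hθ h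
  have h1θ : 0 < 1 - θ := by linarith
  refine le_of_forall_gt fun s hs => ?_
  obtain ⟨s', hs', hss'⟩ := ENNReal.lt_iff_exists_nnreal_btwn.1 hs
  refine lt_of_le_of_lt ?_ hss'
  have hs0 : 0 < (s' : ℝ) := by
    have : (0 : ℝ≥0∞) < s' := zero_le.trans_lt hs'
    exact_mod_cast this
  have hzero := hausdorffMeasure_of_dimH_lt hs'
  -- With this exponent, `(r ^ (1 - θ)) ^ q = r ^ s'`.
  set q : ℝ≥0 := s' / Real.toNNReal (1 - θ) with hq
  have hqr : (q : ℝ) = s' / (1 - θ) := by rw [hq, NNReal.coe_div, Real.coe_toNNReal _ h1θ.le]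
  have hq0 : 0 < (q : ℝ) := by rw [hqr]; positivity
  suffices hΨ : Measure.hausdorffMeasure q Ψ.limitSet = 0 by
    have := dimH_le_of_hausdorffMeasure_ne_top (d := q) (s := Ψ.limitSet)
      (by rw [hΨ]; exact ENNReal.zero_ne_top)
    calc _ ≤ ENNReal.ofReal (1 - θ) * q := by gcongr
      _ = s' := by
        rw [ENNReal.ofReal, ← ENNReal.coe_mul, hq,
          mul_div_cancel₀ _ (Real.toNNReal_pos.2 h1θ).ne']
  refine hausdorffMeasure_eq_zero_of_forall_cover.{u} hq0 fun ε hε => ?_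
  set D : ℝ≥0∞ := M * ENNReal.ofReal A ^ (q : ℝ) with hD
  have hDt : D ≠ ∞ :=
    ENNReal.mul_ne_top hM (ENNReal.rpow_ne_top_of_nonneg hq0.le ENNReal.ofReal_ne_top)
  -- `ε' < 1` forces every radius below `1`, as the ball lemma requires; `D * ε' ≤ ε` pays for its
  -- constants.
  obtain ⟨ε', hε', hε'1, hε'D⟩ : ∃ ε' : ℝ≥0∞, ε' ≠ 0 ∧ ε' < 1 ∧ D * ε' ≤ ε := by
    refine ⟨min (1 / 2) (ε / (D + 1)), ?_, ?_, ?_⟩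
    · refine (lt_min (by simp) (ENNReal.div_pos (by exact_mod_cast hε.ne') ?_)).ne'
      exact ENNReal.add_ne_top.2 ⟨hDt, ENNReal.one_ne_top⟩
    · exact (min_le_left _ _).trans_lt (by simp)
    · calc D * min (1 / 2) (ε / (D + 1)) ≤ (D + 1) * (ε / (D + 1)) := by
            gcongr
            · exact le_self_add
            · exact min_le_right _ _
        _ ≤ ε := ENNReal.mul_div_le
  obtain ⟨x, r, hr, hcov, hsum⟩ :=
    exists_closedBall_cover_of_hausdorffMeasure_eq_zero hs0 hzero hε'
  have hr1 : ∀ i, (r i : ℝ) < 1 := by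
    intro i
    have h1 : (r i : ℝ≥0∞) ^ (s' : ℝ) < 1 := ((ENNReal.le_tsum i).trans hsum).trans_lt hε'1
    have h2 : (r i : ℝ≥0∞) < 1 := by
      by_contra hcon
      exact absurd h1 (not_lt.2 (ENNReal.one_le_rpow (not_lt.1 hcon) hs0))
    exact_mod_cast h2
  choose ι hι t hcard hdiam hmem using fun i => hcover (x i) (r i) (hr i) (hr1 i)
  refine ⟨Σ i, ι i, inferInstance, fun j => t j.1 j.2, ?_, ?_⟩
  · intro z hz
    obtain ⟨ω, hω⟩ := Ψ.exists_coding_of_mem_limitSet hz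
    obtain ⟨y, hy⟩ := Φ.exists_forall_mem_comp_image hXne hXc hXV ω
    obtain ⟨i, hi⟩ := mem_iUnion.1 (hcov (Φ.mem_limitSet_of_forall_mem ω hy))
    have hyi : y ∈ closedBall (x i) (r i) := by
      rw [mem_closedEBall, edist_le_coe] at hi
      exact_mod_cast hi
    obtain ⟨j, hj⟩ := mem_iUnion.1 (hmem i ω y z hyi hy hω)
    exact mem_iUnion.2 ⟨⟨i, j⟩, hj⟩
  · rw [ENNReal.tsum_sigma fun i j => ediam (t i j) ^ (q : ℝ)]
    refine le_trans ?_ hε'D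
    refine le_trans ?_ (mul_le_mul_right hsum D)
    rw [← ENNReal.tsum_mul_left]
    refine ENNReal.tsum_le_tsum fun i => ?_
    have hrpos : (0 : ℝ) < r i := hr i
    have hd : ∀ j, ediam (t i j) ^ (q : ℝ) ≤ ENNReal.ofReal A ^ (q : ℝ) * (r i : ℝ≥0∞) ^ (s' : ℝ) := by
      intro j
      refine (ENNReal.rpow_le_rpow (hdiam i j) hq0.le).trans_eq ?_
      rw [ENNReal.ofReal_mul hA, ENNReal.mul_rpow_of_nonneg _ _ hq0.le,
        ← ENNReal.ofReal_rpow_of_pos hrpos, ← ENNReal.rpow_mul, hqr,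
        mul_div_cancel₀ _ h1θ.ne', ENNReal.ofReal_coe_nnreal]
    calc ∑' j, ediam (t i j) ^ (q : ℝ)
        ≤ ∑' _ : ι i, 1 * (ENNReal.ofReal A ^ (q : ℝ) * (r i : ℝ≥0∞) ^ (s' : ℝ)) := by
          simp only [one_mul]
          exact ENNReal.tsum_le_tsum hd
      _ ≤ M * (ENNReal.ofReal A ^ (q : ℝ) * (r i : ℝ≥0∞) ^ (s' : ℝ)) := by
          rw [ENNReal.tsum_mul_right]
          gcongr
          exact hcard i
      _ = D * (r i : ℝ≥0∞) ^ (s' : ℝ) := by rw [hD, mul_assoc]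

omit [NeZero d] in
theorem dimH_le_natCast (s : Set (EuclideanSpace ℝ (Fin d))) : dimH s ≤ d :=
  (dimH_mono (subset_univ s)).trans_eq (by rw [Real.dimH_univ_eq_finrank, finrank_euclideanSpace_fin])

theorem continuous_dimH_limitSet [∀ n, Fintype (I n)] [∀ n, Nonempty (I n)] (hXne : X.Nonempty)
    (hXc : IsCompact X) (hXi : closure (interior X) = X) (hVo : IsOpen V) (hVc : IsConnected V)
    (hXV : X ⊆ V) (hK : 1 ≤ K) (hη : η < 1) :
    Continuous fun Φ : Ku X V K η N I => dimH Φ.1.limitSet := by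
  have hd0 : (0 : ℝ) < d := by exact_mod_cast Nat.pos_of_ne_zero (NeZero.ne d)
  refine continuous_iff_continuousAt.2 fun Φ => ?_
  have hη0 := Φ.1.pos_of_word (fun n => Classical.arbitrary (I n)) hXne hXV
  refine (ENNReal.tendsto_nhds (ne_top_of_le_ne_top (ENNReal.natCast_ne_top d)
    (dimH_le_natCast _))).2 fun ε hε => ?_
  obtain ⟨ε', hε', hε'ε⟩ := ENNReal.lt_iff_exists_nnreal_btwn.1 hε
  have hε'0 : (0 : ℝ) < ε' := by exact_mod_cast hε'
  -- The factor `1 - θ` loses `θ * dimH`, at most `θ * d`.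
  obtain ⟨θ, hθ, hθ1, hθd⟩ : ∃ θ : ℝ, 0 < θ ∧ θ < 1 ∧ θ * d ≤ ε' := by
    refine ⟨min (1 / 2) (ε' / d), by positivity,
      (min_le_left _ _).trans_lt (by norm_num), ?_⟩
    rw [← le_div_iff₀ hd0]
    exact min_le_right _ _
  have hc : 1 < η ^ (-θ) := Real.one_lt_rpow_of_pos_of_lt_one_of_neg hη0 hη (by linarith)
  have key : ∀ Φ Ψ : NCIFS X V K η N I,
      ENNReal.ofReal (1 - θ) * dimH Ψ.limitSet ≤ dimH Φ.limitSet →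
      dimH Ψ.limitSet ≤ dimH Φ.limitSet + ε := by
    intro Φ Ψ h
    calc dimH Ψ.limitSet
        = ENNReal.ofReal (1 - θ) * dimH Ψ.limitSet + ENNReal.ofReal θ * dimH Ψ.limitSet := by
          rw [← add_mul, ← ENNReal.ofReal_add (by linarith) hθ.le, sub_add_cancel,
            ENNReal.ofReal_one, one_mul]
      _ ≤ dimH Φ.limitSet + ENNReal.ofReal θ * d := by
          gcongr
          exact dimH_le_natCast _
      _ ≤ dimH Φ.limitSet + ε := by
          gcongr
          refine le_trans ?_ hε'ε.le
          rw [← ENNReal.ofReal_natCast, ← ENNReal.ofReal_mul hθ.le]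
          exact (ENNReal.ofReal_le_ofReal hθd).trans_eq ENNReal.ofReal_coe_nnreal
  filter_upwards [eventually_scale_le hXne hXc hVo hVc hXV hK hη Φ hc] with Ψ h
  have h1 := ofReal_mul_dimH_limitSet_le Φ.2.1 hXne hXc hXi hVo hVc hXV hK hη hθ hθ1
    fun ω n x hx => (h ω n x hx).1
  have h2 := ofReal_mul_dimH_limitSet_le Ψ.2.1 hXne hXc hXi hVo hVc hXV hK hη hθ hθ1
    fun ω n x hx => (h ω n x hx).2
  exact ⟨tsub_le_iff_right.2 (key _ _ h2), key _ _ h1⟩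

end Dimension

end NCIFS

end NonAut

theorem mainTheorem9 {d : ℕ} (hd : 1 ≤ d) (X V : Set (EuclideanSpace ℝ (Fin d)))
    (hXne : X.Nonempty) (hXc : IsCompact X) (hXi : closure (interior X) = X)
    (hVo : IsOpen V) (hVc : IsConnected V) (hXV : X ⊆ V)
    (K : ℝ) (hK : 1 ≤ K) (η : ℝ) (hη : η < 1) (N : ℕ)
    (I : ℕ → Type*) [∀ n, Fintype (I n)] [∀ n, Nonempty (I n)] :
    (∀ t : ℝ, 0 ≤ t →
      (∀ Ψ : NonAut.Ku X V K η N I, Ψ.1.lowerPressure t ≠ ⊥ ∧ Ψ.1.lowerPressure t ≠ ⊤) ∧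
      Continuous (fun Ψ : NonAut.Ku X V K η N I => Ψ.1.lowerPressure t)) ∧
    ((∀ Φ : NonAut.Ku X V K η N I, dimH Φ.1.limitSet ≤ (d : ENNReal)) ∧
      Continuous (fun Φ : NonAut.Ku X V K η N I => dimH Φ.1.limitSet)) := by
  have : NeZero d := ⟨by lia⟩
  exact ⟨fun t ht => ⟨fun Ψ => Ψ.1.lowerPressure_ne_bot_and_ne_top Ψ.2.1 hXne hXc hXi hVo hXV hK hη ht,
    NonAut.NCIFS.continuous_lowerPressure hXne hXc hXi hVo hVc hXV hK hη ht⟩,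
    fun Φ => NonAut.NCIFS.dimH_le_natCast _,
    NonAut.NCIFS.continuous_dimH_limitSet hXne hXc hXi hVo hVc hXV hK hη⟩
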